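/- Let $k\ge 1$ be an integer and let $(U_n)_{n\ge 0}$ be the sequence defined by $U_0=0$, $U_1=1$ and $U_n=kU_{n-1}+U_{n-2}$ for $n\ge 2$. For an integer $m\ge 2$ let $\pi(m)$ denote the length of the period of $(U_n)$ modulo $m$, that is, the least integer $t\ge 1$ such that $U_{n+t}\equiv U_n \pmod m$ for all $n\ge 0$. A prime $p$ is called a $k$-Wall-Sun-Sun prime if $\pi(p^2)=\pi(p)$. A monic polynomial $f(x)\in\mathbb{Z}[x]$ that is irreducible over $\mathbb{Q}$ is called monogenic if $\{1,\theta,\theta^2,\ldots,\theta^{\deg f-1}\}$ is a $\mathbb{Z}$-basis of the ring of integers of $\mathbb{Q}(\theta)$, where $f(\theta)=0$; otherwise such an $f(x)$ is called non-monogenic. Theorem. Let $p$ be a prime and let $k\ge 1$ be an integer such that $k\not\equiv 0\pmod 4$ and $\mathcal{D}:=(k^2+4)/\gcd(2,k)^2$ is squarefree. Then the polynomial $\mathcal{F}_p(x):=x^{2p}-kx^p-1$ is irreducible over $\mathbb{Q}$, and $p$ is a $k$-Wall-Sun-Sun prime if and only if $\mathcal{F}_p(x)$ is non-monogenic. Furthermore,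 if $p$ divides $k^2+4$, then $\mathcal{F}_p(x)$ is monogenic. -/

import Mathlib

open Polynomial NumberField

/-- The Lucas sequence of the first kind `U₀ = 0`, `U₁ = 1`, `Uₙ = k Uₙ₋₁ + Uₙ₋₂`. -/
def lucasU (k : ℕ) : ℕ → ℕ
  | 0 => 0
  | 1 => 1
  | n + 2 => k * lucasU k (n + 1) + lucasU k n

/-- The period length of `(Uₙ)` modulo `m`: the least `t ≥ 1` such that
`Uₙ₊ₜ ≡ Uₙ (mod m)` for every `n ≥ 0`. -/
noncomputable def lucasPeriod (k m : ℕ) : ℕ :=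
  sInf {t : ℕ | 0 < t ∧ ∀ n : ℕ, lucasU k (n + t) ≡ lucasU k n [MOD m]}

/-- `p` is a `k`-Wall-Sun-Sun prime. -/
def IsWallSunSunPrime (k p : ℕ) : Prop :=
  p.Prime ∧ lucasPeriod k (p ^ 2) = lucasPeriod k p

/-- `1, θ, …, θ ^ (N - 1)` is a `ℤ`-basis of the ring of integers of `K`. -/
def IsPowerIntegralBasis (K : Type*) [Field K] (θ : K) (N : ℕ) : Prop :=
  ∃ b : Module.Basis (Fin N) ℤ (𝓞 K), ∀ i : Fin N, ((b i : 𝓞 K) : K) = θ ^ (i : ℕ)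

/-- For `f` irreducible over `ℚ`, with root `θ` in the field `K = ℚ[x]/(f) = ℚ(θ)`:
the powers `1, θ, …, θ ^ (deg f - 1)` form a basis of the ring of integers of `K`. -/
def RootPowersIntegralBasis (f : ℤ[X]) (hf : Irreducible (f.map (Int.castRingHom ℚ))) : Prop :=
  haveI : Fact (Irreducible (f.map (Int.castRingHom ℚ))) := ⟨hf⟩
  IsPowerIntegralBasis (AdjoinRoot (f.map (Int.castRingHom ℚ)))
    (AdjoinRoot.root (f.map (Int.castRingHom ℚ))) f.natDegree

/-- A monic polynomial, irreducible over `ℚ`, that is monogenic. -/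
def IsMonogenic (f : ℤ[X]) : Prop :=
  f.Monic ∧ ∃ hf : Irreducible (f.map (Int.castRingHom ℚ)), RootPowersIntegralBasis f hf

/-- A monic polynomial, irreducible over `ℚ`, that is not monogenic. -/
def IsNonMonogenic (f : ℤ[X]) : Prop :=
  f.Monic ∧ ∃ hf : Irreducible (f.map (Int.castRingHom ℚ)), ¬ RootPowersIntegralBasis f hf

/-- The polynomial `x ^ (2p) - k x ^ p - 1`. -/
noncomputable def lucasPoly (k p : ℕ) : ℤ[X] :=
  X ^ (2 * p) - C (k : ℤ) * X ^ p - 1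

/-! Write g = x² - kx - 1, let ω be a root of g, and let V be the companion sequence, so V_p = ω^p +
ω̄^p. For odd p both sides of the equivalence are measured by whether p² divides V_p - k;
divisibility by p always holds.

Arithmetic side: the period modulo m is the order of ω in (ℤ/m)[ω]. If p ∤ k² + 4, then ω^(p²) = ω
modulo p. Lifting this to p² is governed by V_p - k, because V_(p²) ≡ V_p modulo p²
(`isWallSunSunPrime_iff_sq_dvd_of_not_dvd`). If p ∣ k² + 4, or p = 2, a direct computation shows
that the period changes from p to p².

Algebraic side: by Uchida's criterion, monogenicity follows once F_p avoids M² for every maximal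
ideal M of ℤ[X]. Away from p, the discriminant factor k² + 4 and the squarefree hypothesis exclude
membership (`prime_mem_of_lucasPoly_mem_sq`). Above an odd p, the expansion F_p = g^p + p(w x^p + g
c) with V_p - k = p w reduces membership to p ∣ w. Conversely, p ∣ w makes g(θ)^(p-1)/p an integral
element outside ℤ[θ] (`not_rootPowersIntegralBasis_of_sq_dvd`).

Irreducibility amounts to ω not being a p-th power in ℚ(ω); a p-th root would be a unit of norm -1
whose discriminant contradicts the hypotheses (`omega_ne_pow`). -/

/-! ### Maximal ideals of ℤ[X] and Uchida's criterion -/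

instance isJacobsonRing_int : IsJacobsonRing ℤ := by
  rw [isJacobsonRing_iff_prime_eq]
  intro P hP
  by_cases hP0 : P = ⊥
  · subst hP0
    rw [eq_bot_iff]
    intro x hx
    -- Testing x against itself makes x² + 1 a unit of ℤ, which forces x = 0.
    have h1 := Ideal.mem_jacobson_bot.1 hx x
    rcases Int.isUnit_iff.1 h1 with h | h
    · simpa using h
    · nlinarith [mul_self_nonneg x]
  · exact Ideal.jacobson_eq_self_of_isMaximal (H := hP.isMaximal hP0)

/-- Since ℤ is a Jacobson ring, M contracts to a maximal ideal (q) of ℤ. The image of M in the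
principal ideal domain 𝔽_q[X] has one generator, and h is any lift of it. -/
theorem exists_prime_eq_span_pair (M : Ideal ℤ[X]) [hM : M.IsMaximal] :
    ∃ (q : ℕ) (h : ℤ[X]), q.Prime ∧ M = Ideal.span {(q : ℤ[X]), h} := by
  have hmax : (M.comap (C : ℤ →+* ℤ[X])).IsMaximal := isMaximal_comap_C_of_isJacobsonRing M
  obtain ⟨n, hn⟩ := (IsPrincipalIdealRing.principal (M.comap (C : ℤ →+* ℤ[X]))).principal
  have hn0 : n ≠ 0 := by
    rintro rfl
    have hbot : M.comap (C : ℤ →+* ℤ[X]) = ⊥ := by rw [hn]; simp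
    exact Ring.ne_bot_of_isMaximal_of_not_isField hmax Int.not_isField hbot
  have hnp : Prime n := by
    rw [← Ideal.span_singleton_prime hn0]
    have := hmax.isPrime
    rw [hn] at this
    exact this
  have hqM : ((n.natAbs : ℕ) : ℤ[X]) ∈ M := by
    have h1 : (n.natAbs : ℤ) ∈ M.comap (C : ℤ →+* ℤ[X]) := by
      rw [hn]
      exact Ideal.mem_span_singleton.2 (Int.dvd_natAbs.2 dvd_rfl)
    rwa [Ideal.mem_comap, map_natCast] at h1
  have hq : n.natAbs.Prime := Int.prime_iff_natAbs_prime.1 hnp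
  have : Fact n.natAbs.Prime := ⟨hq⟩
  set q := n.natAbs
  let φ : ℤ[X] →+* (ZMod q)[X] := mapRingHom (Int.castRingHom (ZMod q))
  have hφ : Function.Surjective φ := map_surjective _ (ZMod.ringHom_surjective _)
  obtain ⟨h', hh'⟩ := (IsPrincipalIdealRing.principal (M.map φ)).principal
  obtain ⟨h, rfl⟩ := hφ h'
  have hker : RingHom.ker φ = Ideal.span {(q : ℤ[X])} := by
    rw [Polynomial.ker_mapRingHom, ZMod.ker_intCastRingHom, Ideal.map_span]
    simp
  refine ⟨q, h, hq, ?_⟩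
  have hcomap : (M.map φ).comap φ = M := by
    rw [Ideal.comap_map_of_surjective φ hφ, ← RingHom.ker_eq_comap_bot, hker]
    exact sup_eq_left.2 ((Ideal.span_singleton_le_iff_mem _).2 hqM)
  have h2 : M.map φ = (Ideal.span {h}).map φ := by
    rw [hh', Ideal.map_span]
    simp [Ideal.span]
  rw [← hcomap, h2, Ideal.comap_map_of_surjective φ hφ, ← RingHom.ker_eq_comap_bot, hker,
    ← Ideal.span_union, Set.union_comm, Set.singleton_union]

/-- With M = (q, h), write qF = q²a + qhb + h²c. As q is prime in ℤ[X], it divides h or c, and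
cancelling q leaves F in M. -/
theorem mem_of_prime_mul_mem_sq {M : Ideal ℤ[X]} [hM : M.IsMaximal] {q : ℕ} (hq : q.Prime)
    (hqM : (q : ℤ[X]) ∈ M) {F : ℤ[X]} (hF : (q : ℤ[X]) * F ∈ M ^ 2) : F ∈ M := by
  obtain ⟨r, h, hr, hMe⟩ := exists_prime_eq_span_pair M
  have hqr : q = r := by
    by_contra hne
    have hc : IsCoprime (q : ℤ) (r : ℤ) := Nat.isCoprime_iff_coprime.2 ((Nat.coprime_primes hq hr).2 hne)
    obtain ⟨a, b, hab⟩ := hc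
    refine hM.ne_top ((Ideal.eq_top_iff_one M).2 ?_)
    have h1 : (1 : ℤ[X]) = C a * (q : ℤ[X]) + C b * (r : ℤ[X]) := by
      have := congrArg (C : ℤ → ℤ[X]) hab
      simpa using this.symm
    rw [h1]
    refine M.add_mem (M.mul_mem_left _ hqM) (M.mul_mem_left _ ?_)
    rw [hMe]
    exact Ideal.subset_span (by simp)
  subst hqr
  have hqp : Prime (q : ℤ[X]) := by
    have := (Polynomial.prime_C_iff (R := ℤ)).2 (Nat.prime_iff_prime_int.1 hq)
    simpa using this
  have hh : h ∈ M := by rw [hMe]; exact Ideal.subset_span (by simp)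
  have hexp : ∃ a b c : ℤ[X], (q : ℤ[X]) * F = q * q * a + q * h * b + h * h * c := by
    have h3 : M ^ 2 ≤ Ideal.span {(q : ℤ[X]) * q, q * h, h * h} := by
      rw [pow_two, hMe, Ideal.span_pair_mul_span_pair]
      refine Ideal.span_mono ?_
      intro x hx
      simp only [Set.mem_insert_iff, Set.mem_singleton_iff] at hx ⊢
      rcases hx with h | h | h | h <;> simp [h, mul_comm]
    obtain ⟨a, y, hy, h4⟩ := Ideal.mem_span_insert.1 (h3 hF)
    obtain ⟨b, c, rfl⟩ := Ideal.mem_span_pair.1 hy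
    exact ⟨a, b, c, by rw [h4]; ring⟩
  obtain ⟨a, b, c, he⟩ := hexp
  have hdvd : (q : ℤ[X]) ∣ h * h * c := ⟨F - q * a - h * b, by linear_combination -he⟩
  have hq0 : (q : ℤ[X]) ≠ 0 := hqp.ne_zero
  rcases hqp.dvd_or_dvd hdvd with h5 | ⟨c', rfl⟩
  · have h6 : (q : ℤ[X]) ∣ h := by rcases hqp.dvd_or_dvd h5 with h | h <;> exact h
    obtain ⟨h', rfl⟩ := h6
    have : F = q * (a + h' * b + h' * h' * c) := mul_left_cancel₀ hq0 (by linear_combination he)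
    rw [this]
    exact M.mul_mem_right _ hqM
  · have : F = q * a + h * b + h * (h * c') := mul_left_cancel₀ hq0 (by linear_combination he)
    rw [this]
    exact M.add_mem (M.add_mem (M.mul_mem_right _ hqM) (M.mul_mem_right _ hh)) (M.mul_mem_right _ hh)

theorem dvd_of_intCast_mem {M : Ideal ℤ[X]} [hM : M.IsMaximal] {q : ℕ} (hq : q.Prime)
    (hqM : (q : ℤ[X]) ∈ M) {n : ℤ} (hn : (n : ℤ[X]) ∈ M) : (q : ℤ) ∣ n := by
  by_contra hne
  have hc : IsCoprime (q : ℤ) n := ((Nat.prime_iff_prime_int.1 hq).coprime_iff_not_dvd).2 hne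
  obtain ⟨a, b, hab⟩ := hc
  refine hM.ne_top ((Ideal.eq_top_iff_one M).2 ?_)
  have h1 : (1 : ℤ[X]) = (a : ℤ[X]) * (q : ℤ[X]) + (b : ℤ[X]) * (n : ℤ[X]) := by
    exact_mod_cast hab.symm
  rw [h1]
  exact M.add_mem (M.mul_mem_left _ hqM) (M.mul_mem_left _ hn)

theorem sq_dvd_of_intCast_mem_sq {M : Ideal ℤ[X]} [hM : M.IsMaximal] {q : ℕ} (hq : q.Prime)
    (hqM : (q : ℤ[X]) ∈ M) {n : ℤ} (hn : (n : ℤ[X]) ∈ M ^ 2) : (q : ℤ) ^ 2 ∣ n := by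
  obtain ⟨m, rfl⟩ := dvd_of_intCast_mem hq hqM (Ideal.pow_le_self two_ne_zero hn)
  have h1 : (m : ℤ[X]) ∈ M := mem_of_prime_mul_mem_sq hq hqM (by push_cast at hn; exact hn)
  rw [pow_two]
  exact mul_dvd_mul_left _ (dvd_of_intCast_mem hq hqM h1)

/-- Uchida's criterion: `ℤ[θ]` is integrally closed as soon as a polynomial vanishing at `θ` lies
outside the square of every maximal ideal of `ℤ[X]`. -/
theorem isIntegrallyClosed_of_notMem_sq {S : Type*} [CommRing S] [IsDomain S] (φ : ℤ[X] →+* S)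
    (hφ : Function.Surjective φ) (f : ℤ[X]) (hf : φ f = 0)
    (h : ∀ M : Ideal ℤ[X], M.IsMaximal → f ∉ M ^ 2) : IsIntegrallyClosed S := by
  have : IsNoetherianRing S := isNoetherianRing_of_surjective _ _ φ hφ
  refine IsIntegrallyClosed.of_localization_maximal fun P _ hP => ?_
  have hMmax : (P.comap φ).IsMaximal := Ideal.comap_isMaximal_of_surjective φ hφ
  obtain ⟨q, h', hq, hMe⟩ := exists_prime_eq_span_pair (P.comap φ)
  have hfM : f ∈ P.comap φ := by simp [Ideal.mem_comap, hf]
  have hqM : (q : ℤ[X]) ∈ P.comap φ := by rw [hMe]; exact Ideal.subset_span (by simp)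
  have hhM : h' ∈ P.comap φ := by rw [hMe]; exact Ideal.subset_span (by simp)
  have hPe : P = Ideal.span {φ q, φ h'} := by
    rw [← Ideal.map_comap_of_surjective φ hφ P, hMe, Ideal.map_span, Set.image_pair]
  have hab : ∃ a b : ℤ[X], a * q + b * h' = f := by
    have h1 := hfM
    rw [hMe] at h1
    exact Ideal.mem_span_pair.1 h1
  obtain ⟨a, b, hab⟩ := hab
  -- If both coefficients lay in M, then f = aq + bh' would lie in M². So one of them becomes a unit
  -- at P, and the relation aq + bh' = 0 expresses one generator of the maximal ideal through the
  -- other.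
  have hunit : a ∉ P.comap φ ∨ b ∉ P.comap φ := by
    by_contra! hcon
    refine h _ hMmax ?_
    rw [← hab, pow_two]
    exact Ideal.add_mem _ (Ideal.mul_mem_mul hcon.1 hqM) (Ideal.mul_mem_mul hcon.2 hhM)
  let L := Localization.AtPrime P
  have hrel : algebraMap S L (φ a) * algebraMap S L (φ q) +
      algebraMap S L (φ b) * algebraMap S L (φ h') = 0 := by
    rw [← map_mul, ← map_mul, ← map_mul, ← map_mul, ← map_add, ← map_add, hab, hf, map_zero]
  have hmaxe : IsLocalRing.maximalIdeal L =
      Ideal.span {algebraMap S L (φ q), algebraMap S L (φ h')} := by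
    rw [← Localization.AtPrime.map_eq_maximalIdeal, ← Set.image_pair, ← Ideal.map_span, ← hPe]
  have hprin : (IsLocalRing.maximalIdeal L).IsPrincipal := by
    have key : ∀ x y u v : L, IsUnit u → u * x + v * y = 0 → Ideal.span {x, y} = Ideal.span {y} := by
      intro x y u v hu huv
      obtain ⟨w, hw⟩ := hu.exists_left_inv
      refine le_antisymm ?_ (Ideal.span_mono (by simp))
      rw [Ideal.span_le]
      rintro z (rfl | rfl)
      · exact Ideal.mem_span_singleton.2 ⟨-(w * v), by linear_combination w * huv - z * hw⟩
      · exact Ideal.mem_span_singleton_self _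
    rcases hunit with hu | hu
    · rw [hmaxe, key _ _ _ _ (IsLocalization.map_units L (⟨φ a, hu⟩ : P.primeCompl)) hrel]
      exact ⟨_, rfl⟩
    · rw [hmaxe, Set.pair_comm, key _ _ _ _ (IsLocalization.map_units L (⟨φ b, hu⟩ : P.primeCompl))
        (by rw [add_comm]; exact hrel)]
      exact ⟨_, rfl⟩
  have : IsNoetherianRing L := IsLocalization.isNoetherianRing P.primeCompl L inferInstance
  -- A Noetherian local domain with principal maximal ideal is integrally closed.
  have htf := (tfae_of_isNoetherianRing_of_isLocalRing_of_isDomain L).out 3 4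
  exact (htf.2 hprin).1

/-! ### The companion sequence and its congruences modulo p and p² -/

/-- The companion Lucas sequence `V₀ = 2`, `V₁ = k`, `Vₙ = k Vₙ₋₁ + Vₙ₋₂` over a ring. -/
def lucasV {R : Type*} [CommRing R] (k : R) : ℕ → R
  | 0 => 2
  | 1 => k
  | n + 2 => k * lucasV k (n + 1) + lucasV k n

theorem pow_add_pow_eq_lucasV {R A : Type*} [CommRing R] [CommRing A] (φ : R →+* A) {k : R}
    {a b : A} (hs : a + b = φ k) (hm : a * b = -1) (n : ℕ) : a ^ n + b ^ n = φ (lucasV k n) := by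
  induction n using Nat.twoStepInduction with
  | zero => simp only [pow_zero, lucasV, map_ofNat]; norm_num
  | one => simpa [lucasV] using hs
  | more n h1 h2 =>
    rw [lucasV, map_add, map_mul, ← h1, ← h2, ← hs]
    linear_combination (-a ^ n - b ^ n) * hm

theorem sub_mul_lucasU {A : Type*} [CommRing A] {k : ℕ}
    {a b : A} (hs : a + b = k) (hm : a * b = -1) (n : ℕ) :
    (a - b) * (lucasU k n : A) = a ^ n - b ^ n := by
  induction n using Nat.twoStepInduction with
  | zero => simp [lucasU]
  | one => simp [lucasU]
  | more n h1 h2 =>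
    rw [lucasU, Nat.cast_add, Nat.cast_mul, ← hs]
    linear_combination h1 + (a + b) * h2 + (a ^ n - b ^ n) * hm

theorem map_lucasV {R A : Type*} [CommRing R] [CommRing A] (φ : R →+* A) (k : R) (n : ℕ) :
    φ (lucasV k n) = lucasV (φ k) n := by
  induction n using Nat.twoStepInduction with
  | zero => exact map_ofNat φ 2
  | one => simp [lucasV]
  | more n h1 h2 => simp [lucasV, h1, h2]

/-- The conjugate of `ω` in `R[ω]`, `ω ^ 2 = k ω + 1`. -/
abbrev conjOmega {R : Type*} [CommRing R] (k : R) : QuadraticAlgebra R 1 k := ⟨k, -1⟩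

theorem omega_add_conjOmega {R : Type*} [CommRing R] (k : R) :
    (QuadraticAlgebra.omega : QuadraticAlgebra R 1 k) + conjOmega k = algebraMap R _ k := by
  ext <;> simp

theorem omega_mul_conjOmega {R : Type*} [CommRing R] (k : R) :
    (QuadraticAlgebra.omega : QuadraticAlgebra R 1 k) * conjOmega k = -1 := by
  ext <;> simp [QuadraticAlgebra.re_one, QuadraticAlgebra.im_one]

/-- For odd m the powers ω^m and ω̄^m again have product -1, so they play the role of ω and ω̄ with
sum V_m in place of k. -/
theorem lucasV_lucasV {R : Type*} [CommRing R] (k : R) {m : ℕ} (hm : Odd m) (n : ℕ) :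
    lucasV (lucasV k m) n = lucasV k (m * n) := by
  apply QuadraticAlgebra.algebraMap_injective (R := R) (a := 1) (b := k)
  rw [← pow_add_pow_eq_lucasV _ (omega_add_conjOmega k) (omega_mul_conjOmega k), pow_mul, pow_mul,
    ← pow_add_pow_eq_lucasV (algebraMap R (QuadraticAlgebra R 1 k))
      (pow_add_pow_eq_lucasV _ (omega_add_conjOmega k) (omega_mul_conjOmega k) m)
      (by rw [← mul_pow, omega_mul_conjOmega, hm.neg_one_pow])]

/-- Expand (ω + ω̄)^p over ℤ[X] with generic k = X. The correction E is then a polynomial, so it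
respects congruences in k. -/
theorem exists_lucasV_prime {p : ℕ} (hp : p.Prime) :
    ∃ E : ℤ[X], ∀ x : ℤ, lucasV x p = x ^ p + p * E.eval x := by
  obtain ⟨r, hr⟩ := exists_add_pow_prime_eq hp
    (QuadraticAlgebra.omega : QuadraticAlgebra ℤ[X] 1 X) (conjOmega X)
  rw [omega_add_conjOmega, pow_add_pow_eq_lucasV _ (omega_add_conjOmega _) (omega_mul_conjOmega _),
    mul_assoc (p : QuadraticAlgebra ℤ[X] 1 X), omega_mul_conjOmega] at hr
  refine ⟨r.re, fun x => ?_⟩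
  have h1 := congrArg QuadraticAlgebra.re hr
  rw [← map_pow] at h1
  simp only [QuadraticAlgebra.algebraMap_re, QuadraticAlgebra.re_add, mul_neg, mul_one, neg_mul,
    QuadraticAlgebra.re_neg, QuadraticAlgebra.re_mul, QuadraticAlgebra.re_natCast,
    QuadraticAlgebra.im_natCast, mul_zero, zero_mul, add_zero] at h1
  have h2 := congrArg (evalRingHom x) h1
  rw [map_add, map_lucasV] at h2
  simp at h2
  linarith

theorem prime_dvd_lucasV_sub {p : ℕ} (hp : p.Prime) (k : ℤ) : (p : ℤ) ∣ lucasV k p - k := by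
  obtain ⟨E, hE⟩ := exists_lucasV_prime hp
  have : Fact p.Prime := ⟨hp⟩
  have h1 : (p : ℤ) ∣ k ^ p - k := by
    rw [← ZMod.intCast_zmod_eq_zero_iff_dvd]
    push_cast
    rw [ZMod.pow_card, sub_self]
  rw [hE, add_sub_right_comm]
  exact dvd_add h1 (dvd_mul_right _ _)

/-- V_(p²)(k) is V_p evaluated at V_p(k), and V_p(k) ≡ k modulo p. In V_p(x) = x^p + pE(x) both
terms turn a congruence modulo p into one modulo p². -/
theorem sq_dvd_lucasV_sq_sub {p : ℕ} (hp : p.Prime) (ho : Odd p) (k : ℤ) :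
    (p : ℤ) ^ 2 ∣ lucasV k (p * p) - lucasV k p := by
  obtain ⟨E, hE⟩ := exists_lucasV_prime hp
  have h1 := prime_dvd_lucasV_sub hp k
  have h2 : (p : ℤ) ^ 2 ∣ lucasV k p ^ p - k ^ p := by
    simpa using dvd_sub_pow_of_dvd_sub h1 1
  have h3 : (p : ℤ) ^ 2 ∣ p * (E.eval (lucasV k p) - E.eval k) := by
    rw [pow_two]
    exact mul_dvd_mul_left _ (h1.trans (sub_dvd_eval_sub _ _ _))
  have h4 : lucasV k (p * p) - lucasV k p =
      (lucasV k p ^ p - k ^ p) + p * (E.eval (lucasV k p) - E.eval k) := by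
    rw [← lucasV_lucasV k ho]
    linear_combination hE (lucasV k p) - hE k
  rw [h4]
  exact dvd_add h2 h3

theorem lucasV_sq_sub {k n : ℕ} (hn : Odd n) :
    (lucasV (k : ℤ) n) ^ 2 + 4 = (k ^ 2 + 4) * (lucasU k n : ℤ) ^ 2 := by
  apply QuadraticAlgebra.algebraMap_injective (R := ℤ) (a := 1) (b := (k : ℤ))
  have hs := omega_add_conjOmega (k : ℤ)
  have hm := omega_mul_conjOmega (k : ℤ)
  have h1 := pow_add_pow_eq_lucasV _ hs hm n
  have hs' : (QuadraticAlgebra.omega : QuadraticAlgebra ℤ 1 (k : ℤ)) + conjOmega (k : ℤ) =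
    (k : QuadraticAlgebra ℤ 1 (k : ℤ)) := by rw [hs]; simp
  have h2 := sub_mul_lucasU hs' hm n
  have h3 : (QuadraticAlgebra.omega : QuadraticAlgebra ℤ 1 (k : ℤ)) ^ n * (conjOmega (k : ℤ)) ^ n
    = -1 := by rw [← mul_pow, hm, hn.neg_one_pow]
  simp only [map_add, map_mul, map_pow, ← h1, map_natCast, map_ofNat]
  rw [← hs']
  set a := (QuadraticAlgebra.omega : QuadraticAlgebra ℤ 1 (k : ℤ))
  set b := conjOmega (k : ℤ)
  set u : QuadraticAlgebra ℤ 1 (k : ℤ) := (lucasU k n : QuadraticAlgebra ℤ 1 (k : ℤ))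
  linear_combination (-(a - b) * u - (a ^ n - b ^ n)) * h2 + 4 * h3 - 4 * u ^ 2 * hm

/-! ### Periods as orders of ω -/

theorem omega_pow_succ (R : Type*) [CommRing R] (k n : ℕ) :
    (QuadraticAlgebra.omega : QuadraticAlgebra R 1 (k : R)) ^ (n + 1) =
      ⟨lucasU k n, lucasU k (n + 1)⟩ := by
  induction n with
  | zero => ext <;> simp [lucasU]
  | succ n ih =>
    rw [pow_succ, ih]
    ext <;> simp [lucasU]
    ring

theorem omega_pow_eq_one_iff (k m t : ℕ) :
    (QuadraticAlgebra.omega : QuadraticAlgebra (ZMod m) 1 (k : ZMod m)) ^ t = 1 ↔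
      ∀ n, lucasU k (n + t) ≡ lucasU k n [MOD m] := by
  constructor
  · intro h n
    have h1 : (QuadraticAlgebra.omega : QuadraticAlgebra (ZMod m) 1 (k : ZMod m)) ^ (n + t + 1) =
        QuadraticAlgebra.omega ^ (n + 1) := by
      rw [add_right_comm, pow_add _ _ t, h, mul_one]
    rw [omega_pow_succ, omega_pow_succ] at h1
    exact (ZMod.natCast_eq_natCast_iff _ _ _).1 (congrArg QuadraticAlgebra.re h1)
  · intro h
    have h0 := (ZMod.natCast_eq_natCast_iff _ _ _).2 (h 0)
    have h1 := (ZMod.natCast_eq_natCast_iff _ _ _).2 (h 1)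
    have h2 : (QuadraticAlgebra.omega : QuadraticAlgebra (ZMod m) 1 (k : ZMod m)) ^ (t + 1) =
        QuadraticAlgebra.omega := by
      rw [omega_pow_succ]
      rw [zero_add] at h0
      rw [add_comm] at h1
      ext <;> simp [h0, h1, lucasU]
    have hm := omega_mul_conjOmega (k : ZMod m)
    rw [pow_succ] at h2
    linear_combination (-conjOmega (k : ZMod m)) * h2 +
      ((QuadraticAlgebra.omega : QuadraticAlgebra (ZMod m) 1 (k : ZMod m)) ^ t - 1) * hm

theorem lucasPeriod_eq_orderOf (k m : ℕ) : lucasPeriod k m =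
    orderOf (QuadraticAlgebra.omega : QuadraticAlgebra (ZMod m) 1 (k : ZMod m)) := by
  set w := (QuadraticAlgebra.omega : QuadraticAlgebra (ZMod m) 1 (k : ZMod m)) with hw
  have hset : {t : ℕ | 0 < t ∧ ∀ n : ℕ, lucasU k (n + t) ≡ lucasU k n [MOD m]} =
      {t : ℕ | 0 < t ∧ w ^ t = 1} := by
    ext t
    simp only [Set.mem_ofPred_eq, hw, omega_pow_eq_one_iff]
  rw [lucasPeriod, hset]
  by_cases hf : ∃ t, 0 < t ∧ w ^ t = 1
  · have hmem := Nat.sInf_mem hf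
    refine le_antisymm (Nat.sInf_le ⟨?_, pow_orderOf_eq_one w⟩) (orderOf_le_of_pow_eq_one hmem.1 hmem.2)
    exact orderOf_pos_iff.2 (isOfFinOrder_iff_pow_eq_one.2 hf)
  -- If no power of ω is trivial, both sides take the default value 0.
  · rw [orderOf_eq_zero (fun h => hf (isOfFinOrder_iff_pow_eq_one.1 h))]
    have : {t : ℕ | 0 < t ∧ w ^ t = 1} = ∅ := by
      ext t; simpa using fun h1 h2 => hf ⟨t, h1, h2⟩
    rw [this, Nat.sInf_empty]

/-- A prime is Wall-Sun-Sun exactly when every power of `ω` trivial modulo `p` is trivial modulo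
`p ^ 2`. -/
theorem isWallSunSunPrime_iff (k : ℕ) {p : ℕ} (hp : p.Prime) : IsWallSunSunPrime k p ↔
    ∀ t, (QuadraticAlgebra.omega : QuadraticAlgebra (ZMod p) 1 (k : ZMod p)) ^ t = 1 →
      (QuadraticAlgebra.omega : QuadraticAlgebra (ZMod (p ^ 2)) 1 (k : ZMod (p ^ 2))) ^ t = 1 := by
  rw [IsWallSunSunPrime, and_iff_right hp, lucasPeriod_eq_orderOf, lucasPeriod_eq_orderOf]
  constructor
  · intro h t ht
    rw [← orderOf_dvd_iff_pow_eq_one] at ht ⊢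
    rwa [h]
  · intro h
    refine Nat.dvd_antisymm (orderOf_dvd_of_pow_eq_one (h _ (pow_orderOf_eq_one _)))
      (orderOf_dvd_of_pow_eq_one ?_)
    rw [omega_pow_eq_one_iff]
    intro n
    exact ((omega_pow_eq_one_iff _ _ _).1 (pow_orderOf_eq_one _) n).of_dvd (dvd_pow_self p two_ne_zero)

/-- Modulo p² the element ω^t - 1 is still divisible by p, and taking p-th powers raises this to
divisibility by p² = 0. -/
theorem omega_pow_mul_eq_one {k p t : ℕ}
    (h : (QuadraticAlgebra.omega : QuadraticAlgebra (ZMod p) 1 (k : ZMod p)) ^ t = 1) :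
    (QuadraticAlgebra.omega : QuadraticAlgebra (ZMod (p ^ 2)) 1 (k : ZMod (p ^ 2))) ^ (t * p) = 1 := by
  have h1 : (p : QuadraticAlgebra (ZMod (p ^ 2)) 1 (k : ZMod (p ^ 2))) ∣
      QuadraticAlgebra.omega ^ t - 1 := by
    rcases t with _ | s
    · simp
    have hU := (omega_pow_eq_one_iff _ _ _).1 h
    rw [omega_pow_succ] at h ⊢
    have hre := congrArg QuadraticAlgebra.re h
    have him := congrArg QuadraticAlgebra.im h
    simp only [QuadraticAlgebra.re_one, QuadraticAlgebra.im_one] at hre him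
    have hre' : (p : ℤ) ∣ (lucasU k s : ℤ) - 1 := by
      rw [← ZMod.intCast_zmod_eq_zero_iff_dvd]; push_cast; rw [hre, sub_self]
    have him' : (p : ℤ) ∣ (lucasU k (s + 1) : ℤ) := by
      rw [← ZMod.intCast_zmod_eq_zero_iff_dvd]; push_cast; rw [him]
    obtain ⟨x, hx⟩ := hre'
    obtain ⟨y, hy⟩ := him'
    refine ⟨⟨x, y⟩, ?_⟩
    have hx' := congrArg (Int.cast : ℤ → ZMod (p ^ 2)) hx
    have hy' := congrArg (Int.cast : ℤ → ZMod (p ^ 2)) hy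
    push_cast at hx' hy'
    ext <;> simp [QuadraticAlgebra.re_one, QuadraticAlgebra.im_one, hx', hy']
  have h2 := dvd_sub_pow_of_dvd_sub h1 1
  have h3 : (p : QuadraticAlgebra (ZMod (p ^ 2)) 1 (k : ZMod (p ^ 2))) ^ (1 + 1) = 0 := by
    have : ((p ^ 2 : ℕ) : ZMod (p ^ 2)) = 0 := ZMod.natCast_self _
    have h4 := congrArg (algebraMap (ZMod (p ^ 2))
      (QuadraticAlgebra (ZMod (p ^ 2)) 1 (k : ZMod (p ^ 2)))) this
    rw [map_natCast, map_zero] at h4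
    exact_mod_cast h4
  rw [h3, zero_dvd_iff, one_pow, pow_one, ← pow_mul, sub_eq_zero] at h2
  exact h2

/-! ### Wall-Sun-Sun primes not dividing k² + 4 -/

/-- If `x ↦ x ^ n` sends the roots of `x ^ 2 - k x - 1` to roots with the same sum and the
discriminant is invertible, then its square fixes each root. -/
theorem pow_mul_self_eq_self {A : Type*} [CommRing A] {a b c : A} {n : ℕ} (hn : Odd n)
    (hs : a + b = c) (hm : a * b = -1) (hu : IsUnit (c ^ 2 + 4)) (hp : a ^ n + b ^ n = c) :
    a ^ (n * n) = a := by
  obtain ⟨D, hD⟩ := hu.exists_left_inv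
  have hm' : a ^ n * b ^ n = -1 := by rw [← mul_pow, hm, hn.neg_one_pow]
  have hδ : D * (a - b) * (a - b) = 1 := by
    rw [← hD, ← hs]; linear_combination -4 * D * hm
  have hroot : (a ^ n - a) * (a ^ n - b) = 0 := by
    linear_combination a ^ n * hp - hm' + hm - a ^ n * hs
  -- The ring need not be a domain, so a^n need not equal a or b. This e is an idempotent with a^n =
  -- a where e = 0 and a^n = b where e = 1; powers are then computed on each component.
  set e := D * (a - b) * (a - a ^ n) with he
  have hea : a ^ n = a * (1 - e) + b * e := by
    linear_combination (a - a ^ n) * hδ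
  have heb : b ^ n = b * (1 - e) + a * e := by
    linear_combination hp - hs - hea
  have hee : e * (1 - e) = 0 := by
    have : e * (1 - e) = -(D * (a - b)) ^ 2 * ((a ^ n - a) * (a ^ n - b)) + e * (1 - D * (a - b) * (a - b)) := by
      rw [he]; ring
    rw [this, hroot, hδ]; ring
  have hpow : ∀ j : ℕ, 0 < j → (a * (1 - e) + b * e) ^ j = a ^ j * (1 - e) + b ^ j * e := by
    intro j hj
    induction j, hj using Nat.le_induction with
    | base => simp
    | succ j _ ih =>
      rw [pow_succ, ih]
      linear_combination (-a ^ (j + 1) - b ^ (j + 1) + a ^ j * b + b ^ j * a) * hee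
  rw [pow_mul, hea, hpow n hn.pos, hea, heb]
  linear_combination (2 * b - 2 * a) * hee

theorem charP_cast_quadraticAlgebra (m k : ℕ) :
    (m : QuadraticAlgebra (ZMod m) 1 (k : ZMod m)) = 0 := by
  have h := congrArg (algebraMap (ZMod m) (QuadraticAlgebra (ZMod m) 1 (k : ZMod m)))
    (ZMod.natCast_self m)
  rwa [map_natCast, map_zero] at h

theorem isUnit_sq_add_four {p k m : ℕ} (hp : p.Prime) (hd : ¬ p ∣ k ^ 2 + 4) :
    IsUnit (((k : ℕ) : QuadraticAlgebra (ZMod (p ^ m)) 1 (k : ZMod (p ^ m))) ^ 2 + 4) := by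
  have h1 : IsUnit (((k ^ 2 + 4 : ℕ) : ZMod (p ^ m))) := by
    rw [ZMod.isUnit_iff_coprime]
    exact Nat.Coprime.pow_right _ ((Nat.Prime.coprime_iff_not_dvd hp).2 hd).symm
  have h2 := h1.map (algebraMap (ZMod (p ^ m)) (QuadraticAlgebra (ZMod (p ^ m)) 1 (k : ZMod (p ^ m))))
  rw [map_natCast] at h2
  exact_mod_cast h2

theorem natCast_eq_intCast_lucasV {m k n : ℕ} (h : (m : ℤ) ∣ lucasV (k : ℤ) n - k) :
    ((k : ℕ) : QuadraticAlgebra (ZMod m) 1 (k : ZMod m)) =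
      Int.castRingHom _ (lucasV (k : ℤ) n) := by
  obtain ⟨w, hw⟩ := h
  have h1 : lucasV (k : ℤ) n = k + m * w := by linarith
  rw [h1]
  simp [charP_cast_quadraticAlgebra m k]

theorem dvd_lucasV_sub_of_cast_eq {m k n : ℕ}
    (h : Int.castRingHom _ (lucasV (k : ℤ) n) =
      ((k : ℕ) : QuadraticAlgebra (ZMod m) 1 (k : ZMod m))) : (m : ℤ) ∣ lucasV (k : ℤ) n - k := by
  have h1 := congrArg QuadraticAlgebra.re h
  simp only [eq_intCast, QuadraticAlgebra.re_intCast, QuadraticAlgebra.re_natCast] at h1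
  rw [← ZMod.intCast_zmod_eq_zero_iff_dvd]
  push_cast
  rw [h1, sub_self]

theorem omega_add_conjOmega_cast (m k : ℕ) :
    (QuadraticAlgebra.omega : QuadraticAlgebra (ZMod m) 1 (k : ZMod m)) + conjOmega (k : ZMod m) =
      ((k : ℕ) : QuadraticAlgebra (ZMod m) 1 (k : ZMod m)) := by
  rw [omega_add_conjOmega, map_natCast]

/-- The congruence V_p ≡ k holds modulo p, so ω^(p²-1) = 1 there. A Wall-Sun-Sun prime carries this
to p², whence V_(p²) ≡ k, and V_(p²) ≡ V_p modulo p². Conversely, V_p ≡ k modulo p² bounds the order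
of ω modulo p² by a divisor of p² - 1, prime to p. That order divides tp whenever ω^t = 1 modulo p,
hence divides t. -/
theorem isWallSunSunPrime_iff_sq_dvd_of_not_dvd {p k : ℕ} (hp : p.Prime) (ho : Odd p)
    (hd : ¬ p ∣ k ^ 2 + 4) :
    IsWallSunSunPrime k p ↔ (p : ℤ) ^ 2 ∣ lucasV (k : ℤ) p - k := by
  rw [isWallSunSunPrime_iff k hp]
  have hfix : ∀ m, ((p ^ m : ℕ) : ℤ) ∣ lucasV (k : ℤ) p - k →
      (QuadraticAlgebra.omega : QuadraticAlgebra (ZMod (p ^ m)) 1 (k : ZMod (p ^ m))) ^ (p * p) =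
        QuadraticAlgebra.omega := by
    intro m h
    refine pow_mul_self_eq_self ho (omega_add_conjOmega_cast _ k) (omega_mul_conjOmega _)
      (isUnit_sq_add_four hp hd) ?_
    rw [pow_add_pow_eq_lucasV (Int.castRingHom _) (k := (k : ℤ))
      (by rw [omega_add_conjOmega_cast]; simp) (omega_mul_conjOmega _)]
    exact (natCast_eq_intCast_lucasV h).symm
  have hpp : p * p = (p * p - 1) + 1 := by
    have := Nat.mul_pos hp.pos hp.pos
    omega
  have hcancel : ∀ m, (QuadraticAlgebra.omega :
      QuadraticAlgebra (ZMod m) 1 (k : ZMod m)) ^ (p * p) = QuadraticAlgebra.omega →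
      (QuadraticAlgebra.omega : QuadraticAlgebra (ZMod m) 1 (k : ZMod m)) ^ (p * p - 1) = 1 := by
    intro m h
    rw [hpp, pow_succ] at h
    have hm := omega_mul_conjOmega (k : ZMod m)
    linear_combination (-conjOmega (k : ZMod m)) * h +
      ((QuadraticAlgebra.omega : QuadraticAlgebra (ZMod m) 1 (k : ZMod m)) ^ (p * p - 1) - 1) * hm
  constructor
  · intro h
    have h1 := hfix 1 (by simpa using prime_dvd_lucasV_sub hp k)
    rw [pow_one] at h1
    have h2 := h _ (hcancel _ h1)
    have h3 : (QuadraticAlgebra.omega : QuadraticAlgebra (ZMod (p ^ 2)) 1 (k : ZMod (p ^ 2))) ^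
        (p * p) = QuadraticAlgebra.omega := by
      generalize p ^ 2 = m at h2 ⊢
      rw [hpp, pow_succ, h2, one_mul]
    have hm := omega_mul_conjOmega (k : ZMod (p ^ 2))
    have h4 : conjOmega (k : ZMod (p ^ 2)) ^ (p * p) = conjOmega (k : ZMod (p ^ 2)) := by
      have h5 : (QuadraticAlgebra.omega : QuadraticAlgebra (ZMod (p ^ 2)) 1 (k : ZMod (p ^ 2))) ^
        (p * p) * conjOmega (k : ZMod (p ^ 2)) ^ (p * p) = -1 := by
        rw [← mul_pow, hm, (ho.mul ho).neg_one_pow]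
      rw [h3] at h5
      linear_combination -conjOmega (k : ZMod (p ^ 2)) * h5 +
        conjOmega (k : ZMod (p ^ 2)) ^ (p * p) * hm
    have h5 := pow_add_pow_eq_lucasV (Int.castRingHom
      (QuadraticAlgebra (ZMod (p ^ 2)) 1 (k : ZMod (p ^ 2)))) (k := (k : ℤ))
      (by rw [omega_add_conjOmega_cast]; simp) hm (p * p)
    rw [h3, h4, omega_add_conjOmega_cast] at h5
    have h6 := dvd_lucasV_sub_of_cast_eq h5.symm
    have h7 := sq_dvd_lucasV_sq_sub hp ho k
    push_cast at h6
    have h8 := dvd_sub h6 h7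
    simpa using h8
  · intro h t ht
    have h1 := hcancel _ (hfix 2 (by exact_mod_cast h))
    have h2 := omega_pow_mul_eq_one ht
    rw [← orderOf_dvd_iff_pow_eq_one] at h1 h2 ⊢
    refine Nat.Coprime.dvd_of_dvd_mul_right ?_ h2
    refine Nat.Coprime.coprime_dvd_left h1 ?_
    refine ((Nat.Prime.coprime_iff_not_dvd hp).2 fun h3 => ?_).symm
    have h4 := Nat.dvd_sub (dvd_mul_right p p) h3
    rw [show p * p - (p * p - 1) = 1 by omega] at h4
    exact hp.one_lt.ne' (Nat.dvd_one.1 h4)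

/-! ### Odd primes dividing k² + 4 -/

/-- Only p = 3 must be excluded, and -4 is not a square modulo 3. The bound serves to deduce δ^p = 0
from δ⁴ = 0 modulo p², where δ = 2ω - k. -/
theorem four_lt_of_dvd_sq_add_four {p k : ℕ} (hp : p.Prime) (ho : Odd p) (hd : p ∣ k ^ 2 + 4) :
    4 < p := by
  by_contra hlt
  have h3 : p = 3 := by
    have := hp.two_le
    obtain ⟨m, rfl⟩ := ho
    omega
  subst h3
  have h1 := Nat.mod_eq_zero_of_dvd hd
  have : k % 3 = 0 ∨ k % 3 = 1 ∨ k % 3 = 2 := by omega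
  rcases this with h | h | h <;> simp [Nat.add_mod, Nat.pow_mod, h] at h1

theorem exists_add_pow_prime_eq_add {A : Type*} [CommRing A] {p : ℕ} (hp : p.Prime) (x y : A) :
    ∃ z, (x + y) ^ p = x ^ p + y ^ p + p * x ^ (p - 1) * y + p * x * y ^ 2 * z := by
  rw [add_pow_prime_eq hp]
  have hmem : p - 1 ∈ Finset.Ioo 0 p := by
    have := hp.two_le
    simp; omega
  have hdvd : y ∣ ∑ i ∈ (Finset.Ioo 0 p).erase (p - 1),
      x ^ (i - 1) * y ^ (p - i - 1) * ((p.choose i / p : ℕ) : A) := by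
    refine Finset.dvd_sum fun i hi => ?_
    simp only [Finset.mem_erase, Finset.mem_Ioo] at hi
    refine Dvd.dvd.mul_right (Dvd.dvd.mul_left (dvd_pow_self y ?_) _) _
    omega
  obtain ⟨z, hz⟩ := hdvd
  refine ⟨z, ?_⟩
  rw [← Finset.add_sum_erase _ _ hmem, hz]
  have h2 := hp.two_le
  have h3 : p.choose (p - 1) / p = 1 := by
    rw [Nat.choose_symm (by omega : 1 ≤ p), Nat.choose_one_right, Nat.div_self hp.pos]
  rw [h3, show p - (p - 1) - 1 = 0 by omega]
  obtain ⟨q, rfl⟩ : ∃ q, p = q + 2 := ⟨p - 2, by omega⟩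
  simp only [Nat.add_sub_cancel, show q + 2 - 1 = q + 1 by omega]
  push_cast
  ring

theorem two_mul_omega_sub_sq (R : Type*) [CommRing R] (k : ℕ) :
    (2 * QuadraticAlgebra.omega - (k : QuadraticAlgebra R 1 (k : R))) ^ 2 =
      ((k ^ 2 + 4 : ℕ) : QuadraticAlgebra R 1 (k : R)) := by
  have hs := omega_add_conjOmega (k : R)
  rw [map_natCast] at hs
  push_cast
  linear_combination (4 * QuadraticAlgebra.omega) * hs - 4 * omega_mul_conjOmega (k : R)

/-- Here 2ω = k + δ with δ² = k² + 4 = 0 modulo p, so the p-th power map kills δ. -/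
theorem two_mul_omega_pow_of_dvd {p k : ℕ} (hp : p.Prime) (hd : p ∣ k ^ 2 + 4) :
    ((2 ^ p : ℕ) : QuadraticAlgebra (ZMod p) 1 (k : ZMod p)) * QuadraticAlgebra.omega ^ p =
      ((k ^ p : ℕ) : QuadraticAlgebra (ZMod p) 1 (k : ZMod p)) := by
  have h0 := charP_cast_quadraticAlgebra p k
  have hδ := two_mul_omega_sub_sq (ZMod p) k
  obtain ⟨u, hu⟩ := hd
  rw [hu, Nat.cast_mul, h0, zero_mul] at hδ
  obtain ⟨z, hz⟩ := exists_add_pow_prime_eq hp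
    (k : QuadraticAlgebra (ZMod p) 1 (k : ZMod p))
    (2 * QuadraticAlgebra.omega - (k : QuadraticAlgebra (ZMod p) 1 (k : ZMod p)))
  rw [h0, pow_eq_zero_of_le hp.two_le hδ, add_sub_cancel, mul_pow] at hz
  push_cast
  rw [hz]
  ring

/-- U_p is the ω-coordinate of ω^p, and 2^p ω^p is a scalar modulo p. -/
theorem prime_dvd_lucasU {p k : ℕ} (hp : p.Prime) (ho : Odd p) (hd : p ∣ k ^ 2 + 4) :
    p ∣ lucasU k p := by
  have h1 := two_mul_omega_pow_of_dvd hp hd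
  obtain ⟨q, hq⟩ : ∃ q, p = q + 1 := ⟨p - 1, by have := hp.pos; omega⟩
  have h2 : (QuadraticAlgebra.omega : QuadraticAlgebra (ZMod p) 1 (k : ZMod p)) ^ p =
      ⟨lucasU k q, lucasU k p⟩ := by
    have := omega_pow_succ (ZMod p) k q
    rwa [← hq] at this
  rw [h2] at h1
  have h3 := congrArg QuadraticAlgebra.im h1
  simp only [QuadraticAlgebra.im_mul, QuadraticAlgebra.re_natCast, QuadraticAlgebra.im_natCast,
    zero_mul, mul_zero, add_zero] at h3
  rw [← Nat.cast_mul, ZMod.natCast_eq_zero_iff] at h3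
  refine (hp.dvd_mul.1 h3).resolve_left fun h4 => ?_
  have h5 := (Nat.prime_dvd_prime_iff_eq hp Nat.prime_two).1 (hp.dvd_of_dvd_pow h4)
  subst h5
  exact absurd ho (by decide)

/-- From V_p² + 4 = (k² + 4)U_p² and p ∣ U_p, the left side is divisible by p². If V_p ≡ k modulo
p², so is k² + 4. -/
theorem not_sq_dvd_lucasV_sub {p k : ℕ} (hp : p.Prime) (ho : Odd p) (hd : p ∣ k ^ 2 + 4)
    (hd2 : ¬ p ^ 2 ∣ k ^ 2 + 4) : ¬ (p : ℤ) ^ 2 ∣ lucasV (k : ℤ) p - k := by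
  intro h
  have hpp : Prime (p : ℤ) := Nat.prime_iff_prime_int.1 hp
  have hdz : (p : ℤ) ∣ (k : ℤ) ^ 2 + 4 := by exact_mod_cast hd
  have h1 := lucasV_sq_sub (k := k) ho
  have hV : (p : ℤ) ^ 2 ∣ lucasV (k : ℤ) p ^ 2 + 4 - (k ^ 2 + 4) := by
    have : lucasV (k : ℤ) p ^ 2 + 4 - (k ^ 2 + 4) = (lucasV (k : ℤ) p - k) * (lucasV (k : ℤ) p + k) := by
      ring
    rw [this]
    exact h.mul_right _
  have hU : (p : ℤ) ∣ (lucasU k p : ℤ) := Int.natCast_dvd_natCast.2 (prime_dvd_lucasU hp ho hd)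
  have h2 : (p : ℤ) ^ 2 ∣ lucasV (k : ℤ) p ^ 2 + 4 := by
    rw [h1]
    exact ((pow_dvd_pow_of_dvd hU 2)).mul_left _
  apply hd2
  have := (dvd_sub_right h2).1 hV
  exact_mod_cast this

/-- The exponent 4p separates the two moduli. Modulo p², (2ω)^p = k^p + p k^(p-1) δ, and the δ-term
survives in the fourth power because p divides neither 2 nor k. -/
theorem not_isWallSunSunPrime_of_dvd {p k : ℕ} (hp : p.Prime) (ho : Odd p) (hd : p ∣ k ^ 2 + 4) :
    ¬ IsWallSunSunPrime k p := by
  rw [isWallSunSunPrime_iff k hp]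
  intro h
  have h4 := four_lt_of_dvd_sq_add_four hp ho hd
  have hp2 : ¬ p ∣ 2 := fun h5 => by
    have := Nat.le_of_dvd two_pos h5
    omega
  have hpk : ¬ p ∣ k := fun h5 => by
    have h6 : p ∣ 2 ^ 2 := (Nat.dvd_add_right (dvd_pow h5 two_ne_zero)).1 hd
    exact hp2 (hp.dvd_of_dvd_pow h6)
  -- Modulo p one has (2ω)^p = k^p, and k² = -4 gives k⁴ = 2⁴.
  have hmod : (QuadraticAlgebra.omega : QuadraticAlgebra (ZMod p) 1 (k : ZMod p)) ^ (p * 4) = 1 := by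
    have h1 := congrArg (· ^ 4) (two_mul_omega_pow_of_dvd hp hd)
    simp only [mul_pow] at h1
    have h2 : ((k ^ p : ℕ) : QuadraticAlgebra (ZMod p) 1 (k : ZMod p)) ^ 4 =
        ((2 ^ p : ℕ) : QuadraticAlgebra (ZMod p) 1 (k : ZMod p)) ^ 4 := by
      have h3 : ((k ^ 2 + 4 : ℕ) : QuadraticAlgebra (ZMod p) 1 (k : ZMod p)) = 0 := by
        obtain ⟨u, hu⟩ := hd
        rw [hu, Nat.cast_mul, charP_cast_quadraticAlgebra, zero_mul]
      have h5 : ((k : ℕ) : QuadraticAlgebra (ZMod p) 1 (k : ZMod p)) ^ 4 = 2 ^ 4 := by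
        push_cast at h3
        linear_combination ((k : QuadraticAlgebra (ZMod p) 1 (k : ZMod p)) ^ 2 - 4) * h3
      push_cast
      rw [← pow_mul, ← pow_mul, mul_comm p 4, pow_mul, pow_mul, h5]
    rw [h2, ← pow_mul] at h1
    have hu : IsUnit ((2 ^ p : ℕ) : ZMod p) := by
      rw [ZMod.isUnit_iff_coprime]
      exact ((Nat.Prime.coprime_iff_not_dvd hp).2 fun h6 => hp2 (hp.dvd_of_dvd_pow h6)).symm
    have hu' := (hu.map (algebraMap (ZMod p) (QuadraticAlgebra (ZMod p) 1 (k : ZMod p)))).pow 4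
    rw [map_natCast] at hu'
    exact hu'.mul_left_cancel (by rw [h1, mul_one])
  have h1 := h _ hmod
  have h0 := charP_cast_quadraticAlgebra (p ^ 2) k
  have hδ := two_mul_omega_sub_sq (ZMod (p ^ 2)) k
  obtain ⟨u, hu⟩ := hd
  obtain ⟨z, hz⟩ := exists_add_pow_prime_eq_add hp
    (k : QuadraticAlgebra (ZMod (p ^ 2)) 1 (k : ZMod (p ^ 2)))
    (2 * QuadraticAlgebra.omega - (k : QuadraticAlgebra (ZMod (p ^ 2)) 1 (k : ZMod (p ^ 2))))
  set δ := 2 * QuadraticAlgebra.omega - (k : QuadraticAlgebra (ZMod (p ^ 2)) 1 (k : ZMod (p ^ 2)))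
    with hδdef
  rw [hu, Nat.cast_mul] at hδ
  push_cast at h0
  have hδ4 : δ ^ p = 0 := by
    refine pow_eq_zero_of_le h4.le ?_
    linear_combination (δ ^ 2 + p * u) * hδ + (u : QuadraticAlgebra (ZMod (p ^ 2)) 1 (k : ZMod (p ^ 2))) ^ 2 * h0
  rw [hδ4, hδ, hδdef, add_sub_cancel, ← hδdef, mul_pow] at hz
  have hz' := congrArg (· ^ 4) hz
  simp only [mul_pow, ← pow_mul] at hz'
  rw [h1] at hz'
  -- This is the ω-coordinate of the fourth power: the binomial coefficient 4 times the ω-coordinate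
  -- 2 of δ gives the 8.
  have h2 : ((8 * k ^ (p * 3) * (p * k ^ (p - 1)) : ℕ) : ZMod (p ^ 2)) = 0 := by
    have h3 : ((2 ^ (p * 4) : ℕ) : QuadraticAlgebra (ZMod (p ^ 2)) 1 (k : ZMod (p ^ 2))) =
        ((k ^ (p * 4) : ℕ) : QuadraticAlgebra (ZMod (p ^ 2)) 1 (k : ZMod (p ^ 2))) +
        ((4 * k ^ (p * 3) * (p * k ^ (p - 1)) : ℕ) :
          QuadraticAlgebra (ZMod (p ^ 2)) 1 (k : ZMod (p ^ 2))) * δ := by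
      push_cast
      rw [mul_one] at hz'
      rw [hz', pow_mul, pow_mul]
      generalize (k : QuadraticAlgebra (ZMod (p ^ 2)) 1 (k : ZMod (p ^ 2))) ^ p = x
      generalize (k : QuadraticAlgebra (ZMod (p ^ 2)) 1 (k : ZMod (p ^ 2))) ^ (p - 1) = y
      set v := y * δ + p * (k * u * z)
      linear_combination (6 * x ^ 2 * v ^ 2 + 4 * x * p * v ^ 3 + p ^ 2 * v ^ 4 +
        4 * x ^ 3 * (k * u * z)) * h0
    have h5 := congrArg QuadraticAlgebra.im h3
    have h6 : δ.im = 2 := by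
      rw [hδdef, two_mul]
      simp [one_add_one_eq_two]
    simp only [QuadraticAlgebra.im_add, QuadraticAlgebra.im_mul, QuadraticAlgebra.re_natCast,
      QuadraticAlgebra.im_natCast, zero_mul, mul_zero, add_zero, zero_add, h6] at h5
    push_cast at h5 ⊢
    linear_combination -h5
  rw [ZMod.natCast_eq_zero_iff, pow_two, show 8 * k ^ (p * 3) * (p * k ^ (p - 1)) =
    p * (2 ^ 3 * k ^ (p * 3) * k ^ (p - 1)) by ring] at h2
  have h3 := Nat.dvd_of_mul_dvd_mul_left hp.pos h2
  rcases hp.dvd_mul.1 h3 with h3 | h3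
  · rcases hp.dvd_mul.1 h3 with h3 | h3
    · exact hp2 (hp.dvd_of_dvd_pow h3)
    · exact hpk (hp.dvd_of_dvd_pow h3)
  · exact hpk (hp.dvd_of_dvd_pow h3)

/-! ### The prime 2 -/

/-- Modulo 2 the shift by 2 (k even) or 3 (k odd) fixes the sequence, but U₂ = k and U₃ = k² + 1
respectively are nonzero modulo 4. -/
theorem not_isWallSunSunPrime_two {k : ℕ} (hk4 : ¬ k ≡ 0 [MOD 4]) : ¬ IsWallSunSunPrime k 2 := by
  rw [isWallSunSunPrime_iff k Nat.prime_two]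
  intro h
  have hk4' : k % 4 ≠ 0 := hk4
  have key : ∀ t, (∀ n, lucasU k (n + t) ≡ lucasU k n [MOD 2]) →
      ∀ n, lucasU k (n + t) ≡ lucasU k n [MOD 2 ^ 2] := fun t ht =>
    (omega_pow_eq_one_iff _ _ _).1 (h t ((omega_pow_eq_one_iff _ _ _).2 ht))
  have hind : ∀ t, lucasU k t ≡ 0 [MOD 2] → lucasU k (t + 1) ≡ 1 [MOD 2] →
      ∀ n, lucasU k (n + t) ≡ lucasU k n [MOD 2] := by
    intro t h0 h1 n
    induction n using Nat.twoStepInduction with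
    | zero => simpa [lucasU] using h0
    | one => simpa [lucasU, add_comm] using h1
    | more n ih1 ih2 =>
      rw [show n + 2 + t = (n + t) + 2 by ring, lucasU, lucasU]
      rw [show n + 1 + t = n + t + 1 by ring] at ih2
      exact (ih2.mul_left k).add ih1
  rcases Nat.even_or_odd' k with ⟨j, rfl | rfl⟩
  · have h1 := key 2 (hind 2 (by simp [lucasU, Nat.ModEq])
      (by simp [lucasU, Nat.ModEq, Nat.add_mod, Nat.mul_mod])) 0
    simp [lucasU, Nat.ModEq] at h1
    omega
  · have h1 := key 3 (hind 3 (by simp [lucasU, Nat.ModEq, Nat.add_mod, Nat.mul_mod])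
      (by simp [lucasU, Nat.ModEq, Nat.add_mod, Nat.mul_mod])) 0
    simp [lucasU, Nat.ModEq] at h1
    ring_nf at h1
    omega

/-! ### Membership of F_p in squares of maximal ideals -/

theorem eq_two_of_sq_dvd {k q : ℕ} (hD : Squarefree ((k ^ 2 + 4) / Nat.gcd 2 k ^ 2))
    (hq : q.Prime) (h : q ^ 2 ∣ k ^ 2 + 4) : q = 2 ∧ 2 ∣ k := by
  have hnot : ¬ q ^ 2 ∣ (k ^ 2 + 4) / Nat.gcd 2 k ^ 2 := fun hd =>
    hq.one_lt.ne' (Nat.isUnit_iff.1 (hD q (by rwa [← pow_two])))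
  rcases Nat.even_or_odd' k with ⟨j, rfl | rfl⟩
  · refine ⟨?_, dvd_mul_right _ _⟩
    by_contra hq2
    have hg : Nat.gcd 2 (2 * j) = 2 := Nat.gcd_mul_right_right 2 j ▸ by simp
    have he : ((2 * j) ^ 2 + 4) = 4 * (j ^ 2 + 1) := by ring
    rw [hg, he, show (2 : ℕ) ^ 2 = 4 by norm_num, Nat.mul_div_cancel_left _ (by norm_num)] at hnot
    rw [he] at h
    refine hnot (Nat.Coprime.dvd_of_dvd_mul_left ?_ h)
    rw [show (4 : ℕ) = 2 ^ 2 by norm_num]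
    exact Nat.Coprime.pow _ _ ((Nat.coprime_primes hq Nat.prime_two).2 hq2)
  · have hg : Nat.gcd 2 (2 * j + 1) = 1 := by simp
    rw [hg] at hnot
    simp only [one_pow, Nat.div_one] at hnot
    exact absurd h hnot

theorem derivative_mem_of_mem_sq {R : Type*} [CommRing R] {M : Ideal R[X]} {f : R[X]}
    (h : f ∈ M ^ 2) : derivative f ∈ M := by
  rw [pow_two] at h
  induction h using Submodule.mul_induction_on' with
  | mem_mul_mem x hx y hy =>
    rw [derivative_mul]
    exact M.add_mem (M.mul_mem_left _ hy) (M.mul_mem_right _ hx)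
  | add x hx y hy ihx ihy =>
    rw [derivative_add]
    exact M.add_mem ihx ihy

/-- The characteristic polynomial `x ^ 2 - k x - 1` of the Lucas sequence. -/
noncomputable def lucasChar (k : ℕ) : ℤ[X] := X ^ 2 - C (k : ℤ) * X - 1

theorem lucasPoly_eq_expand (k p : ℕ) : lucasPoly k p = expand ℤ p (lucasChar k) := by
  simp [lucasPoly, lucasChar, pow_mul, mul_comm]

theorem lucasChar_monic (k : ℕ) : (lucasChar k).Monic := by
  unfold lucasChar; monicity!

theorem lucasChar_natDegree (k : ℕ) : (lucasChar k).natDegree = 2 := by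
  unfold lucasChar; compute_degree!

theorem exists_lucasPoly_eq_pow_add (k : ℕ) {p : ℕ} (hp : p.Prime) :
    ∃ F : ℤ[X], lucasPoly k p = lucasChar k ^ p + (p : ℤ[X]) * F := by
  have : Fact p.Prime := ⟨hp⟩
  have hker : lucasPoly k p - lucasChar k ^ p ∈ RingHom.ker (mapRingHom (Int.castRingHom (ZMod p))) := by
    rw [RingHom.mem_ker, map_sub, map_pow, lucasPoly_eq_expand, coe_mapRingHom, map_expand,
      ZMod.expand_card, sub_self]
  rw [Polynomial.ker_mapRingHom, ZMod.ker_intCastRingHom, Ideal.map_span, Set.image_singleton,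
    Ideal.mem_span_singleton] at hker
  obtain ⟨F, hF⟩ := hker
  refine ⟨F, ?_⟩
  rw [map_natCast] at hF
  rw [← hF]; ring

/-- In ℤ[X]/(g) the conjugate X̄ of X satisfies X^p X̄^p = -1, so X^(2p) - kX^p - 1 = X^p(X^p + X̄^p
- k). -/
theorem exists_lucasPoly_eq_mul_add (k : ℕ) {p : ℕ} (ho : Odd p) :
    ∃ c : ℤ[X], lucasPoly k p = X ^ p * C (lucasV (k : ℤ) p - k) + lucasChar k * c := by
  have hs : AdjoinRoot.root (lucasChar k) + (AdjoinRoot.of (lucasChar k) (k : ℤ) -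
      AdjoinRoot.root (lucasChar k)) = AdjoinRoot.of (lucasChar k) (k : ℤ) := by ring
  have hm : AdjoinRoot.root (lucasChar k) * (AdjoinRoot.of (lucasChar k) (k : ℤ) -
      AdjoinRoot.root (lucasChar k)) = -1 := by
    have h1 := AdjoinRoot.mk_self (f := lucasChar k)
    have h2 : lucasChar k = X ^ 2 - C (k : ℤ) * X - 1 := rfl
    rw [congrArg (AdjoinRoot.mk (lucasChar k)) h2] at h1
    simp only [map_sub, map_pow, map_mul, AdjoinRoot.mk_X, AdjoinRoot.mk_C, map_one] at h1
    linear_combination -h1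
  have hV := pow_add_pow_eq_lucasV _ hs hm p
  have hmp := congrArg (· ^ p) hm
  simp only [mul_pow, ho.neg_one_pow] at hmp
  have h1 : AdjoinRoot.mk (lucasChar k) (lucasPoly k p - X ^ p * C (lucasV (k : ℤ) p - k)) = 0 := by
    rw [lucasPoly]
    simp only [map_sub, map_pow, map_mul, AdjoinRoot.mk_X, AdjoinRoot.mk_C, map_one, ← hV, pow_mul]
    linear_combination -hmp
  obtain ⟨c, hc⟩ := AdjoinRoot.mk_eq_zero.1 h1
  exact ⟨c, by rw [← hc]; ring⟩

theorem X_notMem_of_lucasChar_mem {k : ℕ} {M : Ideal ℤ[X]} (hM : M ≠ ⊤) (h : lucasChar k ∈ M) :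
    X ∉ M := fun hX => hM ((Ideal.eq_top_iff_one M).2 (by
  have : (1 : ℤ[X]) = (X - C (k : ℤ)) * X - lucasChar k := by rw [lucasChar]; ring
  rw [this]
  exact M.sub_mem (M.mul_mem_left _ hX) h))

/-- If p ∉ M, the derivative puts 2X^p - k in M, and (2X^p - k)² - 4F_p = k² + 4 lies in M². Hence
q² ∣ k² + 4 for the residue characteristic q, which leaves q = 2 and k = 2j with j odd. Then (X^p -
j)² - F_p = j² + 1 also lies in M², but 4 ∤ j² + 1. -/
theorem prime_mem_of_lucasPoly_mem_sq {k p : ℕ} (hp : p.Prime) (hk4 : ¬ k ≡ 0 [MOD 4])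
    (hD : Squarefree ((k ^ 2 + 4) / Nat.gcd 2 k ^ 2)) {M : Ideal ℤ[X]} [hM : M.IsMaximal]
    (h : lucasPoly k p ∈ M ^ 2) : (p : ℤ[X]) ∈ M := by
  by_contra hpM
  have hfM := Ideal.pow_le_self two_ne_zero h
  have hX : X ∉ M := fun hX => hM.ne_top ((Ideal.eq_top_iff_one M).2 (by
    have hp2 := hp.two_le
    obtain ⟨q, hq⟩ : ∃ q, p = q + 1 := ⟨p - 1, by omega⟩
    have : (1 : ℤ[X]) = (X ^ (p + q) - C (k : ℤ) * X ^ q) * X - lucasPoly k p := by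
      rw [lucasPoly, hq]; ring
    rw [this]
    exact M.sub_mem (M.mul_mem_left _ hX) hfM))
  have hder := derivative_mem_of_mem_sq h
  have h2 : 2 * X ^ p - C (k : ℤ) ∈ M := by
    have : derivative (lucasPoly k p) = (p : ℤ[X]) * (X ^ (p - 1) * (2 * X ^ p - C (k : ℤ))) := by
      have hp2 := hp.two_le
      obtain ⟨q, hq⟩ : ∃ q, p = q + 1 := ⟨p - 1, by omega⟩
      have h1 : 2 * p - 1 = p + q := by omega
      rw [lucasPoly, hq]
      simp [derivative_X_pow]
      rw [show 2 * (q + 1) - 1 = q + 1 + q by omega]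
      ring
    rw [this] at hder
    refine ((hM.isPrime.mem_or_mem ((hM.isPrime.mem_or_mem hder).resolve_left hpM)).resolve_left ?_)
    exact fun h => hX (hM.isPrime.mem_of_pow_mem _ h)
  obtain ⟨q, h', hq, hMe⟩ := exists_prime_eq_span_pair M
  have hqM : (q : ℤ[X]) ∈ M := by rw [hMe]; exact Ideal.subset_span (by simp)
  have h3 : (((k ^ 2 + 4 : ℕ) : ℤ) : ℤ[X]) ∈ M ^ 2 := by
    have : (((k ^ 2 + 4 : ℕ) : ℤ) : ℤ[X]) = (2 * X ^ p - C (k : ℤ)) ^ 2 - 4 * lucasPoly k p := by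
      rw [lucasPoly, pow_mul]; simp; ring
    rw [this]
    exact (M ^ 2).sub_mem (Ideal.pow_mem_pow h2 2) ((M ^ 2).mul_mem_left _ h)
  have h4 := sq_dvd_of_intCast_mem_sq hq hqM h3
  obtain ⟨rfl, j, rfl⟩ := eq_two_of_sq_dvd hD hq (by exact_mod_cast h4)
  have hj : X ^ p - (j : ℤ[X]) ∈ M ∧ ((j ^ 2 + 1 : ℕ) : ℤ) % 4 ≠ 0 := by
    have hjo : j % 4 = 1 ∨ j % 4 = 3 := by
      have : ¬ (2 * j) % 4 = 0 := hk4
      omega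
    constructor
    · obtain ⟨i, hi⟩ : ∃ i, j = 2 * i + 1 := ⟨j / 2, by omega⟩
      have h5 : (X ^ p - (j : ℤ[X])) ^ 2 ∈ M := by
        have : (X ^ p - (j : ℤ[X])) ^ 2 = lucasPoly (2 * j) p +
            ((2 : ℕ) : ℤ[X]) * (2 * (i : ℤ[X]) ^ 2 + 2 * (i : ℤ[X]) + 1) := by
          rw [lucasPoly, pow_mul, hi]; simp; ring
        rw [this]
        exact M.add_mem hfM (M.mul_mem_right _ hqM)
      exact hM.isPrime.mem_of_pow_mem _ h5
    · push_cast
      have : (j : ℤ) % 4 = 1 ∨ (j : ℤ) % 4 = 3 := by omega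
      rcases this with h | h <;> simp [Int.add_emod, pow_two, Int.mul_emod, h]
  have h5 : (((j ^ 2 + 1 : ℕ) : ℤ) : ℤ[X]) ∈ M ^ 2 := by
    have : (((j ^ 2 + 1 : ℕ) : ℤ) : ℤ[X]) = (X ^ p - (j : ℤ[X])) ^ 2 - lucasPoly (2 * j) p := by
      rw [lucasPoly, pow_mul]; simp; ring
    rw [this]
    exact (M ^ 2).sub_mem (Ideal.pow_mem_pow hj.1 2) h
  have h6 := sq_dvd_of_intCast_mem_sq hq hqM h5
  exact hj.2 (Int.emod_eq_zero_of_dvd (by simpa using h6))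

theorem prime_natCast_polynomial {p : ℕ} (hp : p.Prime) : Prime (p : ℤ[X]) := by
  have := (Polynomial.prime_C_iff (R := ℤ)).2 (Nat.prime_iff_prime_int.1 hp)
  simpa using this

theorem not_natCast_dvd_lucasChar {p : ℕ} (hp : p.Prime) (k : ℕ) :
    ¬ (p : ℤ[X]) ∣ lucasChar k := by
  intro h1
  have h2 : C (p : ℤ) ∣ lucasChar k := by simpa using h1
  rw [C_dvd_iff_dvd_coeff] at h2
  have h3 := h2 (lucasChar k).natDegree
  rw [coeff_natDegree, (lucasChar_monic k).leadingCoeff] at h3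
  exact (Nat.prime_iff_prime_int.1 hp).not_dvd_one h3

/-- Comparing the expansion of F_p modulo p with its expansion modulo g shows that p divides a
multiple of g; since p is prime in ℤ[X] and g is monic, p divides the cofactor. -/
theorem exists_lucasPoly_eq {p k : ℕ} (hp : p.Prime) (ho : Odd p) {w : ℤ}
    (hw : lucasV (k : ℤ) p - k = p * w) :
    ∃ c : ℤ[X], lucasPoly k p = lucasChar k ^ p + (p : ℤ[X]) * (X ^ p * C w + lucasChar k * c) := by
  have hpp := prime_natCast_polynomial hp
  obtain ⟨F, hF⟩ := exists_lucasPoly_eq_pow_add k hp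
  obtain ⟨c, hc⟩ := exists_lucasPoly_eq_mul_add k ho
  obtain ⟨q, hq⟩ : ∃ q, p = q + 1 := ⟨p - 1, by have := hp.pos; omega⟩
  have h1 : lucasChar k ^ p = lucasChar k ^ q * lucasChar k := by rw [hq, pow_succ]
  have h2 : C (lucasV (k : ℤ) p - k) = (p : ℤ[X]) * C w := by rw [hw]; simp
  rw [h2] at hc
  have hdvd : (p : ℤ[X]) ∣ lucasChar k * (c - lucasChar k ^ q) :=
    ⟨F - X ^ p * C w, by linear_combination hF - hc + h1⟩
  obtain ⟨c', hc'⟩ := (hpp.dvd_or_dvd hdvd).resolve_left (not_natCast_dvd_lucasChar hp k)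
  exact ⟨c', by linear_combination hc - h1 + lucasChar k * hc'⟩

/-- Write F_p = g^p + pF. Membership in M² gives g ∈ M, then F ∈ M, so wX^p ∈ M. As X is a unit
modulo g, this means p ∣ w. -/
theorem lucasPoly_notMem_sq_of_odd {k p : ℕ} (hp : p.Prime) (ho : Odd p)
    (hV : ¬ (p : ℤ) ^ 2 ∣ lucasV (k : ℤ) p - k) {M : Ideal ℤ[X]} [hM : M.IsMaximal]
    (hpM : (p : ℤ[X]) ∈ M) : lucasPoly k p ∉ M ^ 2 := by
  intro h
  have hfM := Ideal.pow_le_self two_ne_zero h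
  obtain ⟨w, hw⟩ := prime_dvd_lucasV_sub hp (k : ℤ)
  obtain ⟨c, hc⟩ := exists_lucasPoly_eq hp ho hw
  set F := X ^ p * C w + lucasChar k * c with hF
  have hgM : lucasChar k ∈ M := by
    refine hM.isPrime.mem_of_pow_mem p ?_
    rw [← sub_eq_iff_eq_add] at hc
    rw [← hc]
    exact M.sub_mem hfM (M.mul_mem_right _ hpM)
  have hFM : F ∈ M := by
    refine mem_of_prime_mul_mem_sq hp hpM ?_
    rw [← sub_eq_iff_eq_add'] at hc
    rw [← hc]
    exact (M ^ 2).sub_mem h (Ideal.pow_le_pow_right hp.two_le (Ideal.pow_mem_pow hgM p))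
  have hw' : X ^ p * C w ∈ M := by
    rw [← sub_eq_iff_eq_add] at hF
    rw [← hF]
    exact M.sub_mem hFM (M.mul_mem_right _ hgM)
  have hwM : (w : ℤ[X]) ∈ M := by
    have := (hM.isPrime.mem_or_mem hw').resolve_left fun h =>
      X_notMem_of_lucasChar_mem hM.ne_top hgM (hM.isPrime.mem_of_pow_mem _ h)
    simpa using this
  apply hV
  rw [hw, pow_two]
  exact mul_dvd_mul_left _ (dvd_of_intCast_mem hp hpM hwM)

/-- Again F_2 = g² + 2F and both g and F would lie in M. For k ≡ 2 modulo 4, F is 1 modulo 2. For k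
odd, F is X(cX + 1) modulo (2, g), which is prime to g whatever the parity of c. -/
theorem lucasPoly_two_notMem_sq {k : ℕ} (hk4 : ¬ k ≡ 0 [MOD 4]) {M : Ideal ℤ[X]}
    [hM : M.IsMaximal] (h2M : (2 : ℤ[X]) ∈ M) : lucasPoly k 2 ∉ M ^ 2 := by
  intro h
  have hfM := Ideal.pow_le_self two_ne_zero h
  have hk4' : k % 4 ≠ 0 := hk4
  have h1M : (1 : ℤ[X]) ∉ M := fun h1 => hM.ne_top ((Ideal.eq_top_iff_one M).2 h1)
  -- Minus the X²-coefficient of F_2 - g² is k² + k - 2; c is its half.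
  obtain ⟨c, hc⟩ : ∃ c : ℤ, (k : ℤ) ^ 2 + k - 2 = 2 * c := by
    have : (2 : ℤ) ∣ (k : ℤ) ^ 2 + k - 2 := by
      rcases Int.even_or_odd' (k : ℤ) with ⟨j, h | h⟩
      · exact ⟨2 * j ^ 2 + j - 1, by rw [h]; ring⟩
      · exact ⟨2 * j ^ 2 + 3 * j, by rw [h]; ring⟩
    exact this
  set F : ℤ[X] := (k : ℤ[X]) * X ^ 3 - (c : ℤ[X]) * X ^ 2 - (k : ℤ[X]) * X - 1 with hFdef
  have hF : lucasPoly k 2 = lucasChar k ^ 2 + ((2 : ℕ) : ℤ[X]) * F := by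
    have h1 := congrArg (Int.cast : ℤ → ℤ[X]) hc
    push_cast at h1
    rw [lucasPoly, lucasChar, hFdef]
    simp
    linear_combination (-X ^ 2) * h1
  have h2M' : ((2 : ℕ) : ℤ[X]) ∈ M := by simpa using h2M
  have hgM : lucasChar k ∈ M := by
    refine hM.isPrime.mem_of_pow_mem 2 ?_
    have : lucasChar k ^ 2 = lucasPoly k 2 - ((2 : ℕ) : ℤ[X]) * F := by rw [hF]; ring
    rw [this]
    exact M.sub_mem hfM (M.mul_mem_right _ h2M')
  have hFM : F ∈ M := by
    refine mem_of_prime_mul_mem_sq Nat.prime_two h2M' ?_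
    have : ((2 : ℕ) : ℤ[X]) * F = lucasPoly k 2 - lucasChar k ^ 2 := by rw [hF]; ring
    rw [this]
    exact (M ^ 2).sub_mem h (Ideal.pow_mem_pow hgM 2)
  have hXM := X_notMem_of_lucasChar_mem hM.ne_top hgM
  rcases Nat.even_or_odd' k with ⟨j, hj | hj⟩
  · have hjo : j % 2 = 1 := by omega
    obtain ⟨i, hi⟩ : ∃ i, j = 2 * i + 1 := ⟨j / 2, by omega⟩
    obtain ⟨d, hd⟩ : ∃ d : ℤ, c = 2 * d := by
      refine ⟨4 * i ^ 2 + 5 * i + 1, ?_⟩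
      have : (k : ℤ) = 2 * (2 * i + 1) := by rw [hj, hi]; push_cast; ring
      rw [this] at hc
      linarith
    refine h1M ?_
    have : (1 : ℤ[X]) = 2 * ((j : ℤ[X]) * X ^ 3 - (d : ℤ[X]) * X ^ 2 - (j : ℤ[X]) * X) - F := by
      rw [hFdef, hd, hj]; push_cast; ring
    rw [this]
    exact M.sub_mem (M.mul_mem_right _ h2M) hFM
  · have h1 : X * ((c : ℤ[X]) * X + 1) ∈ M := by
      have : X * ((c : ℤ[X]) * X + 1) = 2 * ((j : ℤ[X]) * X ^ 3 + (j : ℤ[X]) * X ^ 2 + X)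
          + (X + 1) * lucasChar k - F := by
        rw [hFdef, lucasChar, hj]; simp; ring
      rw [this]
      exact M.sub_mem (M.add_mem (M.mul_mem_right _ h2M) (M.mul_mem_left _ hgM)) hFM
    have h3 := (hM.isPrime.mem_or_mem h1).resolve_left hXM
    rcases Int.even_or_odd' c with ⟨d, hd | hd⟩
    · refine h1M ?_
      have : (1 : ℤ[X]) = ((c : ℤ[X]) * X + 1) - 2 * ((d : ℤ[X]) * X) := by rw [hd]; push_cast; ring
      rw [this]
      exact M.sub_mem h3 (M.mul_mem_right _ h2M)
    · have h4 : (X + 1 : ℤ[X]) ∈ M := by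
        have : (X + 1 : ℤ[X]) = ((c : ℤ[X]) * X + 1) - 2 * ((d : ℤ[X]) * X) := by rw [hd]; push_cast; ring
        rw [this]
        exact M.sub_mem h3 (M.mul_mem_right _ h2M)
      refine h1M ?_
      have : (1 : ℤ[X]) = lucasChar k - (X - 2) * (X + 1) + 2 * ((j : ℤ[X]) * X) := by
        rw [lucasChar, hj]; simp; ring
      rw [this]
      exact M.add_mem (M.sub_mem hgM (M.mul_mem_left _ h4)) (M.mul_mem_right _ h2M)

/-! ### Power bases and integral closedness of ℤ[θ] -/

theorem aeval_root_map_eq_zero_iff {f : ℤ[X]} (hm : f.Monic) (Q : ℤ[X]) :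
    aeval (AdjoinRoot.root (f.map (Int.castRingHom ℚ))) Q = 0 ↔ f ∣ Q := by
  have h1 : aeval (AdjoinRoot.root (f.map (Int.castRingHom ℚ))) Q =
      AdjoinRoot.mk (f.map (Int.castRingHom ℚ)) (Q.map (Int.castRingHom ℚ)) := by
    rw [← AdjoinRoot.aeval_eq]
    exact (aeval_map_algebraMap ℚ _ Q).symm
  rw [h1, AdjoinRoot.mk_eq_zero, map_dvd_map _ (RingHom.injective_int _) hm]

theorem isIntegral_root_map {f : ℤ[X]} (hm : f.Monic) :
    IsIntegral ℤ (AdjoinRoot.root (f.map (Int.castRingHom ℚ))) :=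
  ⟨f, hm, by rw [← aeval_def]; exact (aeval_root_map_eq_zero_iff hm f).2 dvd_rfl⟩

/-- If every integral element of `ℚ[x]/(f)` is an integer polynomial in the root, the powers of the
root form an integral basis. -/
theorem rootPowersIntegralBasis_of_forall_exists {f : ℤ[X]} (hm : f.Monic)
    (hf : Irreducible (f.map (Int.castRingHom ℚ)))
    (h : haveI : Fact (Irreducible (f.map (Int.castRingHom ℚ))) := ⟨hf⟩
      ∀ x : AdjoinRoot (f.map (Int.castRingHom ℚ)), IsIntegral ℤ x →
        ∃ Q : ℤ[X], aeval (AdjoinRoot.root (f.map (Int.castRingHom ℚ))) Q = x) :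
    RootPowersIntegralBasis f hf := by
  have : Fact (Irreducible (f.map (Int.castRingHom ℚ))) := ⟨hf⟩
  set θ := AdjoinRoot.root (f.map (Int.castRingHom ℚ)) with hθ
  let v : Fin f.natDegree → 𝓞 (AdjoinRoot (f.map (Int.castRingHom ℚ))) :=
    fun i => ⟨θ ^ (i : ℕ), (isIntegral_root_map hm).pow _⟩
  have hf1 : f ≠ 1 := by
    rintro rfl
    simp at hf
  have hcomb : ∀ c : Fin f.natDegree → ℤ,
      algebraMap (𝓞 (AdjoinRoot (f.map (Int.castRingHom ℚ)))) (AdjoinRoot (f.map (Int.castRingHom ℚ)))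
        (∑ i, c i • v i) = aeval θ (∑ i, C (c i) * X ^ (i : ℕ)) := by
    intro c
    rw [map_sum, map_sum]
    refine Finset.sum_congr rfl fun i _ => ?_
    rw [map_zsmul, zsmul_eq_mul, map_mul, map_pow, aeval_X, eq_intCast, map_intCast]
    rfl
  have hli : LinearIndependent ℤ v := by
    rw [Fintype.linearIndependent_iff]
    intro c hc i
    have h1 := hcomb c
    rw [hc] at h1
    have h2 := (aeval_root_map_eq_zero_iff hm _).1 h1.symm
    have h3 : (∑ i, C (c i) * X ^ (i : ℕ) : ℤ[X]) = 0 := by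
      refine eq_zero_of_dvd_of_degree_lt h2 ?_
      rw [degree_eq_natDegree hm.ne_zero]
      refine (degree_sum_fin_lt c)
    have h4 := congrArg (fun P => coeff P (i : ℕ)) h3
    simpa [finsetSum_coeff, coeff_C_mul, coeff_X_pow, Fin.val_inj] using h4
  have hsp : ⊤ ≤ Submodule.span ℤ (Set.range v) := by
    intro x _
    obtain ⟨Q, hQ⟩ := h (algebraMap _ _ x) x.isIntegral_coe
    rw [Submodule.mem_span_range_iff_exists_fun]
    refine ⟨fun i => (Q %ₘ f).coeff i, ?_⟩
    apply RingOfIntegers.coe_injective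
    refine (hcomb _).trans ?_
    have h1 : (∑ i : Fin f.natDegree, C ((Q %ₘ f).coeff i) * X ^ (i : ℕ) : ℤ[X]) = Q %ₘ f := by
      rw [Fin.sum_univ_eq_sum_range (fun i => C ((Q %ₘ f).coeff i) * X ^ i) f.natDegree]
      exact (as_sum_range_C_mul_X_pow' _ (natDegree_modByMonic_lt Q hm hf1)).symm
    rw [h1, ← hQ, ← sub_eq_zero, ← map_sub, aeval_root_map_eq_zero_iff hm]
    exact ⟨-(Q /ₘ f), by linear_combination modByMonic_add_div Q f⟩
  exact ⟨Module.Basis.mk hli hsp, fun i => by rw [Module.Basis.mk_apply]; rfl⟩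

theorem exists_aeval_of_rootPowersIntegralBasis {f : ℤ[X]}
    (hf : Irreducible (f.map (Int.castRingHom ℚ))) (hb : RootPowersIntegralBasis f hf) :
    haveI : Fact (Irreducible (f.map (Int.castRingHom ℚ))) := ⟨hf⟩
    ∀ x : AdjoinRoot (f.map (Int.castRingHom ℚ)), IsIntegral ℤ x →
      ∃ Q : ℤ[X], aeval (AdjoinRoot.root (f.map (Int.castRingHom ℚ))) Q = x := by
  intro x hx
  have : Fact (Irreducible (f.map (Int.castRingHom ℚ))) := ⟨hf⟩
  obtain ⟨b, hb⟩ := hb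
  refine ⟨∑ i, C (b.repr ⟨x, hx⟩ i) * X ^ (i : ℕ), ?_⟩
  have h1 := congrArg (algebraMap (𝓞 (AdjoinRoot (f.map (Int.castRingHom ℚ))))
    (AdjoinRoot (f.map (Int.castRingHom ℚ)))) (b.sum_repr ⟨x, hx⟩)
  refine Eq.trans ?_ h1
  rw [map_sum, map_sum]
  refine Finset.sum_congr rfl fun i _ => ?_
  rw [map_zsmul, zsmul_eq_mul, map_mul, map_pow, aeval_X, eq_intCast, map_intCast]
  exact congrArg _ (hb i).symm

/-- Uchida's criterion makes ℤ[θ] integrally closed. Clearing denominators shows that its fraction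
field is all of ℚ(θ), so it contains every integral element. -/
theorem rootPowersIntegralBasis_of_notMem_sq {f : ℤ[X]} (hm : f.Monic)
    (hf : Irreducible (f.map (Int.castRingHom ℚ)))
    (h : ∀ M : Ideal ℤ[X], M.IsMaximal → f ∉ M ^ 2) : RootPowersIntegralBasis f hf := by
  have : Fact (Irreducible (f.map (Int.castRingHom ℚ))) := ⟨hf⟩
  refine rootPowersIntegralBasis_of_forall_exists hm hf fun x hx => ?_
  set θ := AdjoinRoot.root (f.map (Int.castRingHom ℚ)) with hθ
  let S := (aeval θ : ℤ[X] →ₐ[ℤ] _).range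
  have hS : IsIntegrallyClosed S :=
    isIntegrallyClosed_of_notMem_sq ((aeval θ : ℤ[X] →ₐ[ℤ] _).rangeRestrict : ℤ[X] →+* S)
      (aeval θ).rangeRestrict_surjective f
      (Subtype.ext ((aeval_root_map_eq_zero_iff hm f).2 dvd_rfl)) h
  have hfrac : IsFractionRing S (AdjoinRoot (f.map (Int.castRingHom ℚ))) := by
    refine IsFractionRing.of_field _ _ fun z => ?_
    obtain ⟨P, rfl⟩ := AdjoinRoot.mk_surjective z
    obtain ⟨b, hbm, hb⟩ := IsLocalization.integerNormalization_spec (nonZeroDivisors ℤ) P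
    have hb0 : (b : AdjoinRoot (f.map (Int.castRingHom ℚ))) ≠ 0 := by
      exact_mod_cast nonZeroDivisors.ne_zero hbm
    refine ⟨⟨aeval θ (IsLocalization.integerNormalization (nonZeroDivisors ℤ) P), _, rfl⟩,
      (b : S), ?_⟩
    rw [eq_div_iff (by simp [hb0])]
    have h1 : aeval θ (IsLocalization.integerNormalization (nonZeroDivisors ℤ) P) =
        AdjoinRoot.mk _ ((IsLocalization.integerNormalization (nonZeroDivisors ℤ) P).map
          (algebraMap ℤ ℚ)) := by
      rw [← AdjoinRoot.aeval_eq]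
      exact (aeval_map_algebraMap ℚ _ _).symm
    change _ = aeval θ (IsLocalization.integerNormalization (nonZeroDivisors ℤ) P)
    rw [h1, hb]
    simp [mul_comm]
  have hx' : IsIntegral S x := hx.tower_top
  obtain ⟨y, hy⟩ := (IsIntegrallyClosed.isIntegral_iff (R := S)).1 hx'
  obtain ⟨Q, hQ⟩ := y.2
  exact ⟨Q, hQ.trans hy⟩

/-! ### Failure of monogenicity when p² divides V_p - k -/

theorem lucasPoly_natDegree (k : ℕ) {p : ℕ} : (lucasPoly k p).natDegree = 2 * p := by
  rw [lucasPoly_eq_expand, natDegree_expand, lucasChar_natDegree]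

theorem lucasPoly_monic (k : ℕ) {p : ℕ} (hp : p.Prime) : (lucasPoly k p).Monic := by
  rw [lucasPoly_eq_expand]
  exact (lucasChar_monic k).expand hp.pos

/-- The witness is η = g(θ)^(p-1)/p. If it were Q(θ) with Q in ℤ[X], then, since g^(p-1) has degree
2p - 2 < 2p, reducing Q modulo F_p would make p divide the monic polynomial g^(p-1). -/
theorem not_rootPowersIntegralBasis_of_sq_dvd {k p : ℕ} (hp : p.Prime) (ho : Odd p)
    (hf : Irreducible ((lucasPoly k p).map (Int.castRingHom ℚ)))
    (hV : (p : ℤ) ^ 2 ∣ lucasV (k : ℤ) p - k) :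
    ¬ RootPowersIntegralBasis (lucasPoly k p) hf := by
  intro hb
  have : Fact (Irreducible ((lucasPoly k p).map (Int.castRingHom ℚ))) := ⟨hf⟩
  have hm := lucasPoly_monic k hp
  obtain ⟨w, hw⟩ := hV
  obtain ⟨c, hc⟩ := exists_lucasPoly_eq hp ho (w := p * w) (by rw [hw]; ring)
  set θ := AdjoinRoot.root ((lucasPoly k p).map (Int.castRingHom ℚ)) with hθ
  set g := aeval θ (lucasChar k) with hg
  have hp0 : (p : AdjoinRoot ((lucasPoly k p).map (Int.castRingHom ℚ))) ≠ 0 :=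
    Nat.cast_ne_zero.2 hp.ne_zero
  obtain ⟨q, hq⟩ : ∃ q, p = q + 2 := ⟨p - 2, by have := hp.two_le; omega⟩
  have hrel : g ^ p = -(p * (θ ^ p * (p * w) + g * aeval θ c)) := by
    have h1 := (aeval_root_map_eq_zero_iff hm _).2 (dvd_refl (lucasPoly k p))
    conv at h1 => enter [1, 2]; rw [hc]
    simp [← hθ] at h1
    linear_combination h1
  set η := g ^ (q + 1) / p with hη
  have hηp : η * p = g ^ (q + 1) := div_mul_cancel₀ _ hp0
  have hηg : η * g = -(θ ^ p * (p * w) + g * aeval θ c) := by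
    refine mul_right_cancel₀ hp0 ?_
    have h1 : g ^ p = g ^ (q + 1) * g := by
      rw [← pow_succ]
      exact congrArg (g ^ ·) hq
    linear_combination g * hηp - h1 + hrel
  let N : Submodule ℤ (AdjoinRoot ((lucasPoly k p).map (Int.castRingHom ℚ))) :=
    Submodule.map (aeval θ : ℤ[X] →ₐ[ℤ] _).toLinearMap
      ((Ideal.span {(p : ℤ[X]), lucasChar k}).restrictScalars ℤ)
  have hN : ∀ y, y ∈ N ↔ ∃ a b : ℤ[X], y = aeval θ a * p + aeval θ b * g := by
    intro y
    constructor
    · rintro ⟨Q, hQ, rfl⟩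
      obtain ⟨a, b, rfl⟩ := Ideal.mem_span_pair.1 hQ
      exact ⟨a, b, by simp [hg]⟩
    · rintro ⟨a, b, rfl⟩
      exact ⟨a * p + b * lucasChar k, Ideal.mem_span_pair.2 ⟨a, b, rfl⟩, by simp [hg]⟩
  -- η stabilises the finitely generated module N = (p, g(θ)): ηp = g^(p-1), and ηg = -(θ^p p w + g
  -- c) lies in N because p² ∣ V_p - k.
  have hint : IsIntegral ℤ η := by
    refine isIntegral_of_smul_mem_submodule N ?_ ?_ η ?_
    · rw [Submodule.ne_bot_iff]
      exact ⟨p, (hN _).2 ⟨1, 0, by simp⟩, hp0⟩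
    · have h1 : (Subalgebra.toSubmodule (Algebra.adjoin ℤ {θ})).FG :=
        (isIntegral_root_map hm).fg_adjoin_singleton
      refine Submodule.FG.of_le h1 ?_
      rintro _ ⟨Q, -, rfl⟩
      exact aeval_mem_adjoin_singleton ℤ θ
    · intro y hy
      obtain ⟨a, b, rfl⟩ := (hN y).1 hy
      refine (hN _).2 ⟨-(b * X ^ p * C w), a * lucasChar k ^ q - b * c, ?_⟩
      simp only [smul_eq_mul, map_neg, map_mul, map_sub, map_pow, aeval_X, ← hg]
      simp
      linear_combination aeval θ a * hηp + aeval θ b * hηg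
  obtain ⟨Q, hQ⟩ := exists_aeval_of_rootPowersIntegralBasis hf hb η hint
  have hdvd : lucasPoly k p ∣ lucasChar k ^ (q + 1) - C (p : ℤ) * Q := by
    rw [← aeval_root_map_eq_zero_iff hm]
    have hQ' : aeval θ Q = η := hQ
    simp only [map_sub, map_pow, map_mul, ← hθ, hQ', ← hg, map_natCast]
    linear_combination -hηp
  have hdeg : (lucasChar k ^ (q + 1)).degree < (lucasPoly k p).degree := by
    refine degree_lt_degree ?_
    rw [lucasPoly_natDegree, (lucasChar_monic k).natDegree_pow, lucasChar_natDegree]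
    omega
  rw [← modByMonic_eq_zero_iff_dvd hm, sub_modByMonic, ← smul_eq_C_mul, smul_modByMonic,
    (modByMonic_eq_self_iff hm).2 hdeg, sub_eq_zero, smul_eq_C_mul] at hdvd
  refine not_natCast_dvd_lucasChar hp k ((prime_natCast_polynomial hp).dvd_of_dvd_pow (n := q + 1) ?_)
  rw [hdvd]
  exact ⟨Q %ₘ lucasPoly k p, by simp⟩

/-! ### Irreducibility -/

/-- Multiplying by β² sends b to (t² + 1)b + ta; the sign condition 0 ≤ ta is carried along so that
b cannot decrease. -/
theorem exists_pow_eq_of_mul_self {A : Type*} [CommRing A] {β : A} {t : ℤ}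
    (hβ : β * β = t * β + 1) (m : ℕ) :
    ∃ a b : ℤ, β ^ (2 * (m + 1) + 1) = b * β + a ∧ 0 ≤ t * a ∧ t ^ 2 + 1 ≤ b := by
  induction m with
  | zero =>
    refine ⟨t, t ^ 2 + 1, ?_, mul_self_nonneg t, le_rfl⟩
    push_cast
    linear_combination (β + t) * hβ
  | succ m ih =>
    obtain ⟨a, b, h, ha, hb⟩ := ih
    refine ⟨t * b + a, (t ^ 2 + 1) * b + t * a, ?_, ?_, ?_⟩
    · rw [show 2 * (m + 1 + 1) + 1 = 2 * (m + 1) + 1 + 2 by ring, pow_add, h]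
      push_cast
      linear_combination (b * β + a + b * t) * hβ
    · nlinarith [sq_nonneg t]
    · nlinarith [sq_nonneg t]

/-- A p-th root β of ω has norm a p-th root of -1, which excludes p = 2 and gives norm -1 for odd p.
It is integral, with integer trace t. Writing ω = bβ + a and comparing discriminants yields k² + 4 =
(t² + 4)b², where b ≥ t² + 1; the squarefree hypothesis leaves few values of b. -/
theorem omega_ne_pow {p k : ℕ} (hp : p.Prime) (hk : 1 ≤ k) (hk4 : ¬ k ≡ 0 [MOD 4])
    (hD : Squarefree ((k ^ 2 + 4) / Nat.gcd 2 k ^ 2)) (β : QuadraticAlgebra ℚ 1 (k : ℚ)) :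
    β ^ p ≠ QuadraticAlgebra.omega := by
  intro h
  have hnorm : QuadraticAlgebra.norm β ^ p = -1 := by
    rw [← map_pow, h, QuadraticAlgebra.norm_def]
    simp
  rcases hp.eq_two_or_odd' with rfl | ho
  · have := sq_nonneg (QuadraticAlgebra.norm β)
    rw [hnorm] at this
    norm_num at this
  have hnorm1 : QuadraticAlgebra.norm β = -1 := by
    refine ho.strictMono_pow.injective ?_
    simp only [hnorm, ho.neg_one_pow]
  have hωint : IsIntegral ℤ (QuadraticAlgebra.omega : QuadraticAlgebra ℚ 1 (k : ℚ)) := by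
    refine ⟨lucasChar k, lucasChar_monic k, ?_⟩
    rw [← aeval_def]
    ext <;> simp [lucasChar, pow_two, QuadraticAlgebra.re_one, QuadraticAlgebra.im_one]
  have hβint : IsIntegral ℤ β := IsIntegral.of_pow hp.pos (by rwa [h])
  have hstar : IsIntegral ℤ (star β) :=
    hβint.map (RingHom.toIntAlgHom (starRingEnd (QuadraticAlgebra ℚ 1 (k : ℚ))))
  obtain ⟨t, ht⟩ : ∃ t : ℤ, (t : ℚ) = QuadraticAlgebra.trace β := by
    have h1 : IsIntegral ℤ (algebraMap ℚ (QuadraticAlgebra ℚ 1 (k : ℚ)) (QuadraticAlgebra.trace β)) := by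
      rw [QuadraticAlgebra.algebraMap_trace_eq_add_star]
      exact hβint.add hstar
    have h2 := (isIntegral_algebraMap_iff QuadraticAlgebra.algebraMap_injective).1 h1
    exact IsIntegrallyClosed.isIntegral_iff.1 h2
  have hβ : β * β = t * β + 1 := by
    have h1 := QuadraticAlgebra.sq_eq_trace_smul_sub_norm (z := β)
    rw [hnorm1, ← ht, Algebra.smul_def] at h1
    simp only [map_intCast, map_neg, map_one] at h1
    linear_combination h1
  obtain ⟨m, hm⟩ := ho
  obtain ⟨n, rfl⟩ : ∃ n, m = n + 1 := ⟨m - 1, by have := hp.two_le; omega⟩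
  obtain ⟨a, b, hab, -, hb⟩ := exists_pow_eq_of_mul_self hβ n
  rw [← hm, h] at hab
  have him := congrArg QuadraticAlgebra.im hab
  simp at him
  rw [QuadraticAlgebra.trace_def] at ht
  rw [QuadraticAlgebra.norm_def] at hnorm1
  have hkey : (k : ℤ) ^ 2 + 4 = (t ^ 2 + 4) * b ^ 2 := by
    have : (k : ℚ) ^ 2 + 4 = ((t : ℚ) ^ 2 + 4) * b ^ 2 := by
      rw [ht]
      linear_combination (-4 * b ^ 2) * hnorm1 + (k ^ 2 + 4) * (b * β.im + 1) * him
    exact_mod_cast this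
  have hb0 : 0 < b := by nlinarith [sq_nonneg t]
  -- Only the prime 2 can divide b, and 4 ∣ b would give k = 2j with 4 ∣ j² + 1.
  have hb2 : b = 1 ∨ b = 2 := by
    lift b to ℕ using hb0.le
    lift t ^ 2 to ℕ using sq_nonneg t with s
    have hkey' : k ^ 2 + 4 = (s + 4) * b ^ 2 := by exact_mod_cast hkey
    have hprime : ∀ q : ℕ, q.Prime → q ∣ b → q = 2 ∧ 2 ∣ k := fun q hq hqb =>
      eq_two_of_sq_dvd hD hq (by rw [hkey']; exact (pow_dvd_pow_of_dvd hqb 2).mul_left _)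
    by_contra! hcon
    obtain ⟨q, hq, hqb⟩ := Nat.exists_prime_and_dvd (n := b) (by exact_mod_cast hcon.1)
    obtain ⟨rfl, j, rfl⟩ := hprime q hq hqb
    obtain ⟨c, rfl⟩ := hqb
    obtain ⟨r, hr, hrc⟩ := Nat.exists_prime_and_dvd (n := c) (by
      rintro rfl
      exact hcon.2 rfl)
    obtain ⟨rfl, -⟩ := hprime r hr (hrc.mul_left _)
    obtain ⟨d, rfl⟩ := hrc
    have h1 : j ^ 2 + 1 = 4 * ((s + 4) * d ^ 2) := by linarith
    have h2 : j % 4 = 1 ∨ j % 4 = 3 := by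
      have : ¬ (2 * j) % 4 = 0 := hk4
      omega
    have h3 : (j ^ 2 + 1) % 4 = 0 := by rw [h1]; exact Nat.mul_mod_right _ _
    rcases h2 with h | h <;> simp [Nat.add_mod, Nat.pow_mod, h] at h3
  -- b = 1 forces t = 0 and k = 0; b = 2 forces t² ≤ 1, so k² is 12 or 16, and k = 4 is excluded.
  rcases hb2 with rfl | rfl
  · have : t = 0 := by nlinarith [sq_nonneg t]
    subst this
    norm_num at hkey
    omega
  · have h1 : t ^ 2 = 0 ∨ t ^ 2 = 1 := by
      have := sq_nonneg t
      omega
    rcases h1 with h1 | h1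
    · rw [h1] at hkey
      have h2 : (k : ℤ) ^ 2 = 12 := by linarith
      have h3 : k ≤ 3 := by nlinarith
      interval_cases k <;> simp at h2
    · rw [h1] at hkey
      have h2 : (k : ℤ) ^ 2 = 16 := by linarith
      have h3 : k = 4 := by
        have : k ≤ 4 := by nlinarith
        interval_cases k <;> simp at h2
        rfl
      exact hk4 (by rw [h3]; rfl)

theorem lucasChar_map_irreducible {k : ℕ} (hk : 1 ≤ k) :
    Irreducible ((lucasChar k).map (Int.castRingHom ℚ)) := by
  have hm := (lucasChar_monic k).map (Int.castRingHom ℚ)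
  have hdeg : ((lucasChar k).map (Int.castRingHom ℚ)).natDegree = 2 := by
    rw [(lucasChar_monic k).natDegree_map, lucasChar_natDegree]
  rw [hm.irreducible_iff_roots_eq_zero_of_degree_le_three (by rw [hdeg]) (by rw [hdeg]; norm_num)]
  rw [Multiset.eq_zero_iff_forall_notMem]
  intro x hx
  rw [mem_roots hm.ne_zero, IsRoot.def, eval_map] at hx
  obtain ⟨n, rfl⟩ := IsIntegrallyClosed.isIntegral_iff.1
    (⟨lucasChar k, lucasChar_monic k, hx⟩ : IsIntegral ℤ x)
  have h1 : n * (n - k) = 1 := by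
    simp [lucasChar] at hx
    have : (n : ℚ) * (n - k) = 1 := by linear_combination hx
    exact_mod_cast this
  rcases Int.eq_one_or_neg_one_of_mul_eq_one' h1 with h | h <;> omega

open IntermediateField in
/-- The field generated by a root of an irreducible quadratic polynomial is a quadratic algebra. -/
theorem exists_bijective_quadraticAlgebra {K E : Type*} [Field K] [Field E] [Algebra K E] {a b : K}
    {x : E} (hx : minpoly K x = X ^ 2 - C b * X - C a) :
    ∃ ψ : QuadraticAlgebra K a b →ₐ[K] K⟮x⟯,
      ψ QuadraticAlgebra.omega = AdjoinSimple.gen K x ∧ Function.Bijective ψ := by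
  have hdeg : (X ^ 2 - C b * X - C a : K[X]).natDegree = 2 := by compute_degree!
  have hne : (X ^ 2 - C b * X - C a : K[X]) ≠ 0 := by
    intro h
    rw [h] at hdeg
    simp at hdeg
  have hxint : IsIntegral K x := by
    by_contra hcon
    rw [minpoly.eq_zero hcon] at hx
    exact hne hx.symm
  set y := AdjoinSimple.gen K x with hy
  have hymin : minpoly K y = X ^ 2 - C b * X - C a := by
    rw [hy, minpoly_gen, hx]
  have hyy : y * y = a • (1 : K⟮x⟯) + b • y := by
    have h1 := minpoly.aeval K y
    rw [hymin] at h1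
    simp only [map_sub, map_mul, map_pow, aeval_X, aeval_C] at h1
    rw [Algebra.smul_def, Algebra.smul_def]
    linear_combination h1
  let ψ : QuadraticAlgebra K a b →ₐ[K] K⟮x⟯ := QuadraticAlgebra.lift ⟨y, hyy⟩
  have hψ : ∀ z, ψ z = z.re • 1 + z.im • y := fun z => rfl
  have hψω : ψ QuadraticAlgebra.omega = y := by
    rw [hψ]
    simp
  refine ⟨ψ, hψω, ?_, ?_⟩
  · rw [injective_iff_map_eq_zero]
    intro z hz
    have h1 : aeval y (C z.im * X + C z.re) = 0 := by
      rw [hψ, Algebra.smul_def, Algebra.smul_def] at hz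
      simp only [map_add, map_mul, aeval_C, aeval_X]
      linear_combination hz
    have h2 : (C z.im * X + C z.re : K[X]) = 0 := by
      by_contra hne'
      have h3 := minpoly.degree_le_of_ne_zero K y hne' h1
      rw [hymin, degree_eq_natDegree hne, hdeg] at h3
      have h4 := h3.trans degree_linear_le
      norm_num at h4
    have h5 := congrArg (fun P => coeff P 0) h2
    have h6 := congrArg (fun P => coeff P 1) h2
    simp at h5 h6
    ext
    · exact h5
    · exact h6
  · intro z
    obtain ⟨Q, rfl⟩ := (adjoin.powerBasis hxint).exists_eq_aeval' z
    refine ⟨aeval QuadraticAlgebra.omega Q, ?_⟩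
    rw [← aeval_algHom_apply, hψω]
    rfl

/-- F_p is g composed with X^p, so it suffices that X^p - x is irreducible over ℚ(x) for a root x of
g, that is, that x is not a p-th power there. -/
theorem lucasPoly_map_irreducible {p k : ℕ} (hp : p.Prime) (hk : 1 ≤ k) (hk4 : ¬ k ≡ 0 [MOD 4])
    (hD : Squarefree ((k ^ 2 + 4) / Nat.gcd 2 k ^ 2)) :
    Irreducible ((lucasPoly k p).map (Int.castRingHom ℚ)) := by
  have hm := (lucasChar_monic k).map (Int.castRingHom ℚ)
  have hcomp : (lucasPoly k p).map (Int.castRingHom ℚ) =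
      ((lucasChar k).map (Int.castRingHom ℚ)).comp (X ^ p) := by
    rw [lucasPoly_eq_expand, map_expand, expand_eq_comp_X_pow]
  rw [hcomp]
  refine irreducible_comp hm (monic_X_pow p) (lucasChar_map_irreducible hk) ?_
  intro E _ _ x hx
  rw [Polynomial.map_pow, map_X]
  refine X_pow_sub_C_irreducible_of_prime hp fun b hb => ?_
  obtain ⟨ψ, hψω, hinj, hsurj⟩ := exists_bijective_quadraticAlgebra (a := 1) (b := (k : ℚ))
    (hx.trans (by simp [lucasChar]))
  obtain ⟨β, rfl⟩ := hsurj b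
  refine omega_ne_pow hp hk hk4 hD β (hinj ?_)
  rw [map_pow, hψω]
  exact hb

/-! ### The main theorem, by cases p = 2, p ∣ k² + 4 and p ∤ k² + 4 -/

theorem theorem1p1 (p k : ℕ) (hp : p.Prime) (hk : 1 ≤ k) (hk4 : ¬ k ≡ 0 [MOD 4])
    (hD : Squarefree ((k ^ 2 + 4) / Nat.gcd 2 k ^ 2)) :
    Irreducible ((lucasPoly k p).map (Int.castRingHom ℚ)) ∧
    (IsWallSunSunPrime k p ↔ IsNonMonogenic (lucasPoly k p)) ∧
    (p ∣ k ^ 2 + 4 → IsMonogenic (lucasPoly k p)) := by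
  have hirr := lucasPoly_map_irreducible hp hk hk4 hD
  have hm := lucasPoly_monic k hp
  have hmono : (∀ M : Ideal ℤ[X], M.IsMaximal → (p : ℤ[X]) ∈ M → lucasPoly k p ∉ M ^ 2) →
      RootPowersIntegralBasis (lucasPoly k p) hirr := fun h =>
    rootPowersIntegralBasis_of_notMem_sq hm hirr fun M hM hf =>
      h M hM (prime_mem_of_lucasPoly_mem_sq hp hk4 hD hf) hf
  have hnon : IsNonMonogenic (lucasPoly k p) ↔ ¬ RootPowersIntegralBasis (lucasPoly k p) hirr :=
    ⟨fun h => h.2.2, fun h => ⟨hm, hirr, h⟩⟩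
  rw [hnon]
  rcases hp.eq_two_or_odd' with rfl | ho
  · have hb := hmono fun M hM h2 => lucasPoly_two_notMem_sq hk4 (by simpa using h2)
    exact ⟨hirr, iff_of_false (not_isWallSunSunPrime_two hk4) (not_not_intro hb),
      fun _ => ⟨hm, hirr, hb⟩⟩
  · have hiff : RootPowersIntegralBasis (lucasPoly k p) hirr ↔
        ¬ (p : ℤ) ^ 2 ∣ lucasV (k : ℤ) p - k :=
      ⟨fun hb hV => not_rootPowersIntegralBasis_of_sq_dvd hp ho hirr hV hb,
        fun hV => hmono fun M _ hpM => lucasPoly_notMem_sq_of_odd hp ho hV hpM⟩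
    by_cases hd : p ∣ k ^ 2 + 4
    · have hV := not_sq_dvd_lucasV_sub hp ho hd fun h => by
        obtain ⟨rfl, -⟩ := eq_two_of_sq_dvd hD hp h
        exact absurd ho (by decide)
      have hb := hiff.2 hV
      exact ⟨hirr, iff_of_false (not_isWallSunSunPrime_of_dvd hp ho hd) (not_not_intro hb),
        fun _ => ⟨hm, hirr, hb⟩⟩
    · refine ⟨hirr, ?_, fun h => absurd h hd⟩
      rw [isWallSunSunPrime_iff_sq_dvd_of_not_dvd hp ho hd, hiff, not_not]
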